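/- Fix an integer $k\ge 1$ and a real number $\beta$ with $0<\beta<\tfrac12$. Let $C^+_\beta$ be the set of continuous nondecreasing functions $g:[0,1]\to[0,1]$ with $g(0)=0$, $g(1)=1$ that are continuously differentiable on $[0,\beta]$ and on $[1-\beta,1]$ (with one-sided derivatives at the endpoints of these intervals). Let $\mathcal F_0$ be the set of pairs $(\Gamma,p)$, where $\Gamma=(g_1,\dots,g_k)$ is a $k$-tuple of homeomorphisms $g_i\in C^+_\beta$ and $p=(p_1,\dots,p_k)$ is a probability vector ($p_i\ge 0$, $\sum_i p_i=1$), with the metric $$d\big((\Gamma,p),(\Delta,q)\big)=\sum_{i=1}^k\Big(|p_i-q_i|+\|g_i-h_i\|_\infty+\|g_i^{-1}-h_i^{-1}\|_\infty+\sup_{[0,\beta]\cup[1-\beta,1]}|g_i'-h_i'|\Big),\qquad \Delta=(h_1,\dots,h_k).$$ Call $(\Gamma,p)\in\mathcal F_0$ admissible if $p_i>0$ for all $i$; for every $x\in(0,1)$ there are $i,j$ with $g_i(x)<x<g_j(x)$; and $\sum_i p_i\log g_i'(0)>0$ and $\sum_i p_i\log g_i'(1)>0$ (where $\log 0=-\infty$,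 so that in particular all $g_i'(0)$ and $g_i'(1)$ are positive). Let $\mathcal F\subset\mathcal F_0$ be the set of admissible pairs all of whose maps $g_i$ are absolutely continuous on $[0,1]$, and let $\overline{\mathcal F}$ be its closure in $(\mathcal F_0,d)$. A stationary distribution of $(\Gamma,p)$ in $\mathcal M_1(0,1)$ is a Borel probability measure $\mu$ on $[0,1]$ with $\mu((0,1))=1$ and $\mu(A)=\sum_i p_i\,\mu(g_i^{-1}(A))$ for all Borel sets $A\subset[0,1]$. Theorem. The metric space $(\mathcal F_0,d)$ is complete, and the set of all $(\Gamma,p)\in\overline{\mathcal F}$ that have exactly one stationary distribution in $\mathcal M_1(0,1)$, and for which this distribution is singular with respect to Lebesgue measure, is residual in $\overline{\mathcal F}$ (that is, its complement in $\overline{\mathcal F}$ is of the first category in $\overline{\mathcal F}$). -/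

import Mathlib

noncomputable section

open Set MeasureTheory

namespace IntervalIFS

/-- A self-map `g` of `[0,1]` regarded as a real function (constant to the left of `0` and to the
right of `1`; only its values on `[0,1]` are ever used). -/
def extendReal (g : unitInterval → unitInterval) : ℝ → ℝ :=
  fun x => (g (projIcc 0 1 zero_le_one x) : ℝ)

/-- The fixed neighbourhood `[0,β] ∪ [1-β,1]` of the endpoints. -/
def ends (β : ℝ) : Set ℝ := Icc 0 β ∪ Icc (1 - β) 1

/-- The derivative of `g` along `[0,β] ∪ [1-β,1]`, one-sided at the endpoints of the two
intervals. -/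
def endDeriv (β : ℝ) (g : unitInterval → unitInterval) (x : ℝ) : ℝ :=
  derivWithin (extendReal g) (ends β) x

/-- The class `C⁺_β`: continuous nondecreasing `g : [0,1] → [0,1]` with `g 0 = 0`, `g 1 = 1`,
continuously differentiable on `[0,β]` and on `[1-β,1]`. -/
structure IsCPlus (β : ℝ) (g : unitInterval → unitInterval) : Prop where
  continuous : Continuous g
  monotone : Monotone g
  map_zero : g 0 = 0
  map_one : g 1 = 1
  contDiffOn : ContDiffOn ℝ 1 (extendReal g) (ends β)

/-- The space `𝓕₀`: `k` homeomorphisms of `[0,1]` from the class `C⁺_β`, together with a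
probability vector. -/
@[ext]
structure IFS (k : ℕ) (β : ℝ) where
  /-- the homeomorphisms -/
  map : Fin k → (unitInterval ≃ₜ unitInterval)
  /-- the probability vector -/
  prob : Fin k → ℝ
  isCPlus : ∀ i, IsCPlus β (map i)
  prob_nonneg : ∀ i, 0 ≤ prob i
  prob_sum : ∑ i, prob i = 1

/-- The supremum distance of two real functions (used only for functions with bounded
difference). -/
def supDist {α : Type*} (u v : α → ℝ) : ℝ := ⨆ a, |u a - v a|

theorem supDist_self {α : Type*} (u : α → ℝ) : supDist u u = 0 := by
  simp [supDist]

theorem supDist_comm {α : Type*} (u v : α → ℝ) : supDist u v = supDist v u := by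
  simp only [supDist, abs_sub_comm]

theorem supDist_nonneg {α : Type*} (u v : α → ℝ) : 0 ≤ supDist u v :=
  Real.iSup_nonneg fun _ => abs_nonneg _

theorem bddAbove_sub {α : Type*} {u v : α → ℝ} (hu : ∃ C, ∀ a, |u a| ≤ C)
    (hv : ∃ C, ∀ a, |v a| ≤ C) : BddAbove (range fun a => |u a - v a|) := by
  obtain ⟨C, hC⟩ := hu
  obtain ⟨D, hD⟩ := hv
  refine ⟨C + D, ?_⟩
  rintro _ ⟨a, rfl⟩
  exact (abs_sub _ _).trans (add_le_add (hC a) (hD a))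

theorem supDist_triangle {α : Type*} {u v w : α → ℝ} (hu : ∃ C, ∀ a, |u a| ≤ C)
    (hv : ∃ C, ∀ a, |v a| ≤ C) (hw : ∃ C, ∀ a, |w a| ≤ C) :
    supDist u w ≤ supDist u v + supDist v w := by
  refine Real.iSup_le (fun a => ?_) (add_nonneg (supDist_nonneg _ _) (supDist_nonneg _ _))
  exact (abs_sub_le _ (v a) _).trans
    (add_le_add (le_ciSup (bddAbove_sub hu hv) a) (le_ciSup (bddAbove_sub hv hw) a))

theorem eq_of_supDist_eq_zero {α : Type*} {u v : α → ℝ} (hu : ∃ C, ∀ a, |u a| ≤ C)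
    (hv : ∃ C, ∀ a, |v a| ≤ C) (h : supDist u v = 0) : u = v := by
  funext a
  have h1 : |u a - v a| ≤ supDist u v := le_ciSup (bddAbove_sub hu hv) a
  rw [h] at h1
  exact sub_eq_zero.1 (abs_eq_zero.1 (le_antisymm h1 (abs_nonneg _)))

theorem bounded_coe (g : unitInterval → unitInterval) :
    ∃ C : ℝ, ∀ x, |(g x : ℝ)| ≤ C :=
  ⟨1, fun x => by rw [abs_of_nonneg (g x).2.1]; exact (g x).2.2⟩

theorem uniqueDiffOn_ends {β : ℝ} (hβ : 0 < β) : UniqueDiffOn ℝ (ends β) := by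
  rintro x (hx | hx)
  · exact (uniqueDiffOn_Icc hβ x hx).mono subset_union_left
  · exact (uniqueDiffOn_Icc (by linarith) x hx).mono subset_union_right

theorem isCompact_ends (β : ℝ) : IsCompact (ends β) := isCompact_Icc.union isCompact_Icc

theorem bounded_endDeriv {β : ℝ} {g : unitInterval → unitInterval} (hg : IsCPlus β g) :
    ∃ C : ℝ, ∀ x : ends β, |endDeriv β g x| ≤ C := by
  rcases lt_or_ge 0 β with hβ | hβ
  · obtain ⟨C, hC⟩ := (isCompact_ends β).exists_bound_of_continuousOn
      (hg.contDiffOn.continuousOn_derivWithin (uniqueDiffOn_ends hβ) le_rfl)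
    exact ⟨C, fun x => hC x x.2⟩
  · have hfin : (ends β).Finite :=
      (Set.subsingleton_Icc_of_ge hβ).finite.union
        (Set.subsingleton_Icc_of_ge (by linarith)).finite
    obtain ⟨C, hC⟩ := (hfin.image fun x => |endDeriv β g x|).bddAbove
    exact ⟨C, fun x => hC (mem_image_of_mem _ x.2)⟩

/-- The contribution of one index to the metric on `𝓕₀`:
`|p-q| + ‖g-h‖ + ‖g⁻¹-h⁻¹‖ + sup_{[0,β] ∪ [1-β,1]} |g'-h'|`. -/
def termDist (β : ℝ) (p q : ℝ) (g h : unitInterval ≃ₜ unitInterval) : ℝ :=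
  |p - q| + supDist (fun x => (g x : ℝ)) (fun x => (h x : ℝ))
    + supDist (fun x => (g.symm x : ℝ)) (fun x => (h.symm x : ℝ))
    + supDist (fun x : ends β => endDeriv β g x) (fun x : ends β => endDeriv β h x)

theorem termDist_nonneg (β p q : ℝ) (g h : unitInterval ≃ₜ unitInterval) :
    0 ≤ termDist β p q g h :=
  add_nonneg (add_nonneg (add_nonneg (abs_nonneg _) (supDist_nonneg _ _)) (supDist_nonneg _ _))
    (supDist_nonneg _ _)

/-- The metric `d` on `𝓕₀`. -/
instance instMetricSpaceIFS (k : ℕ) (β : ℝ) : MetricSpace (IFS k β) where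
  dist S T := ∑ i, termDist β (S.prob i) (T.prob i) (S.map i) (T.map i)
  dist_self S := by simp [termDist, supDist_self]
  dist_comm S T := by
    refine Finset.sum_congr rfl fun i _ => ?_
    simp only [termDist]
    rw [abs_sub_comm, supDist_comm, supDist_comm (fun x => ((S.map i).symm x : ℝ)),
      supDist_comm (fun x : ends β => endDeriv β (S.map i) x)]
  dist_triangle S T U := by
    rw [← Finset.sum_add_distrib]
    refine Finset.sum_le_sum fun i _ => ?_
    have h1 := abs_sub_le (S.prob i) (T.prob i) (U.prob i)
    have h2 := supDist_triangle (bounded_coe (S.map i)) (bounded_coe (T.map i))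
      (bounded_coe (U.map i))
    have h3 := supDist_triangle (bounded_coe (S.map i).symm) (bounded_coe (T.map i).symm)
      (bounded_coe (U.map i).symm)
    have h4 := supDist_triangle (bounded_endDeriv (S.isCPlus i)) (bounded_endDeriv (T.isCPlus i))
      (bounded_endDeriv (U.isCPlus i))
    simp only [termDist]
    linarith
  eq_of_dist_eq_zero := by
    intro S T h
    have h0 : ∀ i, termDist β (S.prob i) (T.prob i) (S.map i) (T.map i) = 0 := fun i =>
      (Finset.sum_eq_zero_iff_of_nonneg fun i _ => termDist_nonneg _ _ _ _ _).1 h i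
        (Finset.mem_univ i)
    have key : ∀ i, |S.prob i - T.prob i| = 0 ∧
        supDist (fun x => (S.map i x : ℝ)) (fun x => (T.map i x : ℝ)) = 0 := fun i => by
      have h1 := abs_nonneg (S.prob i - T.prob i)
      have h2 := supDist_nonneg (fun x => (S.map i x : ℝ)) (fun x => (T.map i x : ℝ))
      have h3 := supDist_nonneg (fun x => ((S.map i).symm x : ℝ))
        (fun x => ((T.map i).symm x : ℝ))
      have h4 := supDist_nonneg (fun x : ends β => endDeriv β (S.map i) x)
        (fun x : ends β => endDeriv β (T.map i) x)
      have h5 := h0 i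
      simp only [termDist] at h5
      constructor <;> linarith
    refine IFS.ext (funext fun i => Homeomorph.ext fun x => Subtype.ext ?_) (funext fun i => ?_)
    · exact congrFun (eq_of_supDist_eq_zero (bounded_coe (S.map i)) (bounded_coe (T.map i))
        (key i).2) x
    · exact sub_eq_zero.1 (abs_eq_zero.1 (key i).1)

/-- Admissibility: all probabilities are positive; every `x ∈ (0,1)` is moved strictly to the left
by some map and strictly to the right by some map; the Lyapunov exponents at `0` and at `1` are
positive. The derivatives at `0` and `1` are nonnegative, and a vanishing one would make the
Lyapunov exponent `-∞`, so they have to be positive. -/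
structure IsAdmissible {k : ℕ} {β : ℝ} (S : IFS k β) : Prop where
  prob_pos : ∀ i, 0 < S.prob i
  moves : ∀ x : unitInterval, 0 < x → x < 1 → ∃ i j, S.map i x < x ∧ x < S.map j x
  deriv_zero_pos : ∀ i, 0 < endDeriv β (S.map i) 0
  deriv_one_pos : ∀ i, 0 < endDeriv β (S.map i) 1
  lyapunov_zero_pos : 0 < ∑ i, S.prob i * Real.log (endDeriv β (S.map i) 0)
  lyapunov_one_pos : 0 < ∑ i, S.prob i * Real.log (endDeriv β (S.map i) 1)

/-- The set `𝓕` of admissible systems all of whose maps are absolutely continuous on `[0,1]`. -/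
def admissibleAC (k : ℕ) (β : ℝ) : Set (IFS k β) :=
  {S | IsAdmissible S ∧ ∀ i, AbsolutelyContinuousOnInterval (extendReal (S.map i)) 0 1}

/-- The Markov operator `P μ = ∑ pᵢ gᵢ μ`, where `gᵢ μ` is the push-forward of `μ`. -/
def markov {k : ℕ} {β : ℝ} (S : IFS k β) (μ : Measure unitInterval) : Measure unitInterval :=
  ∑ i, ENNReal.ofReal (S.prob i) • μ.map (S.map i)

/-- `μ` is a stationary distribution in `𝓜₁(0,1)`: a Borel probability measure on `[0,1]` with
`μ (0,1) = 1` and `P μ = μ`. -/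
def IsStationary {k : ℕ} {β : ℝ} (S : IFS k β) (μ : Measure unitInterval) : Prop :=
  IsProbabilityMeasure μ ∧ μ (Ioo 0 1) = 1 ∧ markov S μ = μ

/-- There is exactly one stationary distribution in `𝓜₁(0,1)`, and it is singular with respect to
Lebesgue measure on `[0,1]`. -/
def HasUniqueSingularStationary {k : ℕ} {β : ℝ} (S : IFS k β) : Prop :=
  ∃ μ : Measure unitInterval, IsStationary S μ ∧ (∀ ν, IsStationary S ν → ν = μ) ∧
    μ ⟂ₘ (volume : Measure unitInterval)

end IntervalIFS

end

noncomputable section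

open Set MeasureTheory Filter Topology

namespace IntervalIFS

variable {k : ℕ} {β : ℝ}

theorem IFS.strictMono (S : IFS k β) (i : Fin k) : StrictMono (S.map i) :=
  (S.isCPlus i).monotone.strictMono_of_injective (S.map i).injective

theorem IFS.sum_ofReal_prob (S : IFS k β) : ∑ i, ENNReal.ofReal (S.prob i) = 1 := by
  rw [← ENNReal.ofReal_sum_of_nonneg fun i _ => S.prob_nonneg i, S.prob_sum, ENNReal.ofReal_one]

theorem markov_apply (S : IFS k β) (μ : Measure unitInterval) {E : Set unitInterval}
    (hE : MeasurableSet E) :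
    markov S μ E = ∑ i, ENNReal.ofReal (S.prob i) * μ (S.map i ⁻¹' E) := by
  simp only [markov, Measure.coe_finsetSum, Finset.sum_apply, Measure.smul_apply, smul_eq_mul]
  exact Finset.sum_congr rfl fun i _ => by
    rw [Measure.map_apply (S.map i).continuous.measurable hE]

theorem IsStationary.apply {S : IFS k β} {μ : Measure unitInterval} (h : IsStationary S μ)
    {E : Set unitInterval} (hE : MeasurableSet E) :
    μ E = ∑ i, ENNReal.ofReal (S.prob i) * μ (S.map i ⁻¹' E) := by
  rw [← markov_apply S μ hE, h.2.2]

theorem IsStationary.real_apply {S : IFS k β} {μ : Measure unitInterval} (h : IsStationary S μ)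
    {E : Set unitInterval} (hE : MeasurableSet E) :
    μ.real E = ∑ i, S.prob i * μ.real (S.map i ⁻¹' E) := by
  have := h.1
  rw [measureReal_def, h.apply hE, ENNReal.toReal_sum fun i _ => by finiteness]
  refine Finset.sum_congr rfl fun i _ => ?_
  rw [ENNReal.toReal_mul, ENNReal.toReal_ofReal (S.prob_nonneg i), measureReal_def]

/-- A convex combination with positive weights of numbers not exceeding `m` equals `m` only if all
the numbers are equal to `m`. -/
theorem IFS.eq_of_average_eq (S : IFS k β) (hp : ∀ i, 0 < S.prob i) {a : Fin k → ℝ} {m : ℝ}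
    (ha : ∀ i, a i ≤ m) (h : m = ∑ i, S.prob i * a i) (i : Fin k) : a i = m := by
  have h0 : ∑ j, S.prob j * (m - a j) = 0 := by
    simp only [mul_sub, Finset.sum_sub_distrib, ← Finset.sum_mul, S.prob_sum, ← h]
    ring
  have h1 := (Finset.sum_eq_zero_iff_of_nonneg fun j _ =>
    mul_nonneg (hp j).le (sub_nonneg.2 (ha j))).1 h0 i (Finset.mem_univ i)
  have h2 := (mul_eq_zero.1 h1).resolve_left (hp i).ne'
  linarith

theorem IsStationary.measure_singleton_zero {S : IFS k β} {μ : Measure unitInterval}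
    (h : IsStationary S μ) : μ {0} = 0 := by
  have := h.1
  have h1 : μ (Ioo (0 : unitInterval) 1)ᶜ = 0 := (prob_compl_eq_zero_iff measurableSet_Ioo).2 h.2.1
  exact measure_mono_null (by rintro x rfl; simp) h1

theorem IsStationary.measure_singleton_one {S : IFS k β} {μ : Measure unitInterval}
    (h : IsStationary S μ) : μ {1} = 0 := by
  have := h.1
  have h1 : μ (Ioo (0 : unitInterval) 1)ᶜ = 0 := (prob_compl_eq_zero_iff measurableSet_Ioo).2 h.2.1
  exact measure_mono_null (by rintro x rfl; simp) h1

/-- Every point of `(0,1)` is moved to the right by some map. -/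
def MovesRight (S : IFS k β) : Prop :=
  ∀ x : unitInterval, 0 < x → x < 1 → ∃ j, x < S.map j x

theorem IsAdmissible.movesRight {S : IFS k β} (h : IsAdmissible S) : MovesRight S :=
  fun x h0 h1 => let ⟨_, j, hij⟩ := h.moves x h0 h1; ⟨j, hij.2⟩

theorem IsStationary.nullSingleton {S : IFS k β} {μ : Measure unitInterval}
    (h : IsStationary S μ) (hp : ∀ i, 0 < S.prob i) (hm : MovesRight S) (x : unitInterval) :
    μ {x} = 0 := by
  have := h.1
  by_contra hx
  have hpos : 0 < μ.real {x} := ENNReal.toReal_pos hx (measure_ne_top _ _)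
  have hfin : {y : unitInterval | μ.real {x} ≤ μ.real {y}}.Finite := by
    have := Measure.finite_const_le_meas_of_disjoint_iUnion (μ := μ)
      (As := fun y : unitInterval => {y}) (ε := μ {x}) (pos_iff_ne_zero.2 hx)
      (fun y => measurableSet_singleton y)
      (fun y z hyz => by simpa [Function.onFun] using hyz) (measure_ne_top _ _)
    refine this.subset fun y hy => ?_
    exact (ENNReal.toReal_le_toReal (measure_ne_top _ _) (measure_ne_top _ _)).1 hy
  obtain ⟨z, hz, hzmax⟩ := hfin.exists_maximalFor (fun y => μ.real {y}) _ ⟨x, le_refl (μ.real {x})⟩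
  have hzmax' : ∀ y, μ.real {y} ≤ μ.real {z} := fun y => by
    by_cases hy : μ.real {x} ≤ μ.real {y}
    · by_contra hlt
      exact hlt (hzmax hy (not_le.1 hlt).le)
    · exact (not_le.1 hy).le.trans hz
  have hfin' : {y : unitInterval | μ.real {y} = μ.real {z}}.Finite :=
    hfin.subset fun y (hy : _ = _) => (by rw [mem_ofPred_eq, hy]; exact hz)
  obtain ⟨a, ha, hamin⟩ := hfin'.exists_minimalFor id _ ⟨z, rfl⟩
  have hapos : 0 < μ.real {a} := by
    rw [show μ.real {a} = μ.real {z} from ha]; exact hpos.trans_le hz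
  have ha0 : a ≠ 0 := by
    rintro rfl
    simp [measureReal_def, h.measure_singleton_zero] at hapos
  have ha1 : a ≠ 1 := by
    rintro rfl
    simp [measureReal_def, h.measure_singleton_one] at hapos
  obtain ⟨j, hj⟩ := hm a (unitInterval.pos_iff_ne_zero.2 ha0) (unitInterval.lt_one_iff_ne_one.2 ha1)
  have hinv := h.real_apply (measurableSet_singleton a)
  have hpre : ∀ i, S.map i ⁻¹' {a} = {(S.map i).symm a} := fun i => by
    ext y; simp [Homeomorph.eq_symm_apply]
  simp only [hpre] at hinv
  have hj' : (S.map j).symm a < a := by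
    rw [← (S.strictMono j).lt_iff_lt]; simpa using hj
  have hmem := S.eq_of_average_eq hp (fun i => by
    rw [show μ.real {a} = μ.real {z} from ha]; exact hzmax' _) hinv j
  exact absurd (hamin (hmem.trans ha) hj'.le) (not_le.2 hj')

/-- The distribution function of a measure on `[0,1]` without atoms is continuous. -/
theorem continuous_measureReal_Iic (μ : Measure unitInterval) [IsFiniteMeasure μ]
    (hμ : ∀ x, μ {x} = 0) : Continuous fun x => μ.real (Iic x) := by
  have heq : (fun x => μ.real (Iic x)) =
      fun x => ∫ y, (Iic x).indicator (fun _ => (1 : ℝ)) y ∂μ := by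
    funext x
    rw [integral_indicator_const _ measurableSet_Iic, smul_eq_mul, mul_one]
  rw [heq, continuous_iff_continuousAt]
  intro x
  refine continuousAt_of_dominated (bound := fun _ => 1) (Eventually.of_forall fun y =>
      (aestronglyMeasurable_const.indicator measurableSet_Iic))
    (Eventually.of_forall fun y => Eventually.of_forall fun z => ?_) (integrable_const _) ?_
  · refine (norm_indicator_le_norm_self _ _).trans ?_
    simp
  · have : ∀ᵐ y ∂μ, y ≠ x := by
      rw [ae_iff]; simpa using hμ x
    filter_upwards [this] with y hy
    refine (continuousAt_const (y := if y < x then (1 : ℝ) else 0)).congr ?_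
    rcases lt_or_gt_of_ne hy with hlt | hgt
    · filter_upwards [lt_mem_nhds hlt] with z hz
      simp [hlt, indicator_of_mem (show y ∈ Iic z from le_of_lt hz)]
    · filter_upwards [gt_mem_nhds hgt] with z hz
      simp [not_lt.2 hgt.le, indicator_of_notMem (show y ∉ Iic z from not_le.2 hz)]

theorem IsStationary.measureReal_Iic_le {S : IFS k β} {μ ν : Measure unitInterval}
    (h : IsStationary S μ) (h' : IsStationary S ν) (hp : ∀ i, 0 < S.prob i) (hm : MovesRight S)
    (x : unitInterval) : μ.real (Iic x) ≤ ν.real (Iic x) := by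
  have := h.1
  have := h'.1
  set D : unitInterval → ℝ := fun x => μ.real (Iic x) - ν.real (Iic x) with hD
  have hcont : Continuous D :=
    (continuous_measureReal_Iic μ (h.nullSingleton hp hm)).sub
      (continuous_measureReal_Iic ν (h'.nullSingleton hp hm))
  obtain ⟨z, -, hz⟩ := isCompact_univ.exists_isMaxOn univ_nonempty hcont.continuousOn
  have hz' : ∀ y, D y ≤ D z := fun y => hz (mem_univ y)
  rw [← sub_nonpos]
  refine (hz' x).trans (not_lt.1 fun hpos => ?_)
  have hclosed : IsClosed {y | D y = D z} := isClosed_eq hcont continuous_const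
  obtain ⟨a, ha, hamin⟩ := hclosed.isCompact.exists_isLeast ⟨z, rfl⟩
  have ha : D a = D z := ha
  have ha0 : a ≠ 0 := by
    rintro rfl
    have : Iic (0 : unitInterval) = {0} := by
      ext y; simp
    have h0 : D 0 = 0 := by
      simp [hD, this, measureReal_def, h.measure_singleton_zero, h'.measure_singleton_zero]
    linarith
  have ha1 : a ≠ 1 := by
    rintro rfl
    have : Iic (1 : unitInterval) = univ := by
      ext y; simpa using unitInterval.le_one' (t := y)
    have h1 : D 1 = 0 := by simp [hD, this]
    linarith
  obtain ⟨j, hj⟩ := hm a (unitInterval.pos_iff_ne_zero.2 ha0) (unitInterval.lt_one_iff_ne_one.2 ha1)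
  have hpre : ∀ i, S.map i ⁻¹' Iic a = Iic ((S.map i).symm a) := fun i => by
    ext y
    simp only [mem_preimage, mem_Iic]
    rw [← (S.strictMono i).le_iff_le (b := (S.map i).symm a), Homeomorph.apply_symm_apply]
  have hinv : D a = ∑ i, S.prob i * D ((S.map i).symm a) := by
    simp only [hD, mul_sub, Finset.sum_sub_distrib]
    rw [h.real_apply measurableSet_Iic, h'.real_apply measurableSet_Iic]
    simp only [hpre]
  have hj' : (S.map j).symm a < a := by
    rw [← (S.strictMono j).lt_iff_lt]; simpa using hj
  have hmem := S.eq_of_average_eq hp (fun i => (hz' _).trans ha.ge) hinv j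
  exact absurd (hamin (hmem.trans ha)) (not_le.2 hj')

theorem IsStationary.unique {S : IFS k β} {μ ν : Measure unitInterval}
    (h : IsStationary S μ) (h' : IsStationary S ν) (hp : ∀ i, 0 < S.prob i) (hm : MovesRight S) :
    μ = ν := by
  have := h.1
  have := h'.1
  refine Measure.ext_of_Iic μ ν fun x => ?_
  rw [← ENNReal.toReal_eq_toReal_iff' (measure_ne_top _ _) (measure_ne_top _ _)]
  exact le_antisymm (h.measureReal_Iic_le h' hp hm x) (h'.measureReal_Iic_le h hp hm x)

/-- Forward invariant sets are trivial for the stationary distribution. -/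
theorem IsStationary.measure_eq_zero_or_one {S : IFS k β} {μ : Measure unitInterval}
    (h : IsStationary S μ) (hp : ∀ i, 0 < S.prob i) (hm : MovesRight S) {E : Set unitInterval}
    (hE : MeasurableSet E) (hinv : ∀ i, E ⊆ S.map i ⁻¹' E) : μ E = 0 ∨ μ E = 1 := by
  have := h.1
  by_contra! hne
  obtain ⟨h0, h1⟩ := hne
  have hmeas : ∀ i, Measurable (S.map i) := fun i => (S.map i).continuous.measurable
  have heq : ∀ i, μ.real (S.map i ⁻¹' E) = μ.real E := by
    have := S.eq_of_average_eq hp (a := fun i => 2 * μ.real E - μ.real (S.map i ⁻¹' E))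
      (m := μ.real E) (fun i => by
        have := measureReal_mono (μ := μ) (hinv i)
        linarith) (by
        simp only [mul_sub, Finset.sum_sub_distrib, ← Finset.sum_mul, S.prob_sum]
        rw [← h.real_apply hE]; ring)
    intro i
    have := this i
    linarith
  have hae : ∀ i, (S.map i ⁻¹' E : Set unitInterval) =ᵐ[μ] E := fun i =>
    (ae_eq_of_subset_of_measure_ge (hinv i)
      ((ENNReal.toReal_le_toReal (measure_ne_top _ _) (measure_ne_top _ _)).1 (heq i).le)
      hE.nullMeasurableSet (measure_ne_top _ _)).symm
  have hν : IsStationary S (ProbabilityTheory.cond μ E) := by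
    refine ⟨ProbabilityTheory.cond_isProbabilityMeasure h0, ?_, ?_⟩
    · rw [ProbabilityTheory.cond_apply hE]
      have : μ (E ∩ Ioo 0 1) = μ E := by
        refine measure_congr ((ae_eq_set_inter (ae_eq_refl E) ?_).trans (inter_univ E).eventuallyEq)
        exact ae_eq_univ.2 ((prob_compl_eq_zero_iff measurableSet_Ioo).2 h.2.1)
      rw [this, ENNReal.inv_mul_cancel h0 (measure_ne_top _ _)]
    · ext A hA
      rw [markov_apply _ _ hA, ProbabilityTheory.cond_apply hE]
      simp only [ProbabilityTheory.cond_apply hE]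
      rw [h.apply (hE.inter hA), Finset.mul_sum]
      refine Finset.sum_congr rfl fun i _ => ?_
      have h3 : μ (S.map i ⁻¹' (E ∩ A)) = μ (E ∩ S.map i ⁻¹' A) :=
        measure_congr (ae_eq_set_inter (hae i) (ae_eq_refl _))
      rw [h3]
      ring
  have := h.unique hν hp hm
  have h2 : μ E = ProbabilityTheory.cond μ E E := by rw [← this]
  exact h1 (h2.trans (ProbabilityTheory.cond_apply_self h0 (measure_ne_top _ _)))

/-! ### Coordinates are Lipschitz for the metric -/

theorem termDist_le_dist (S T : IFS k β) (i : Fin k) :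
    termDist β (S.prob i) (T.prob i) (S.map i) (T.map i) ≤ dist S T :=
  Finset.single_le_sum
    (f := fun i => termDist β (S.prob i) (T.prob i) (S.map i) (T.map i))
    (fun _ _ => termDist_nonneg _ _ _ _ _) (Finset.mem_univ i)

theorem abs_prob_sub_le (S T : IFS k β) (i : Fin k) : |S.prob i - T.prob i| ≤ dist S T := by
  refine le_trans ?_ (termDist_le_dist S T i)
  simp only [termDist]
  have h2 := supDist_nonneg (fun x => (S.map i x : ℝ)) (fun x => (T.map i x : ℝ))
  have h3 := supDist_nonneg (fun x => ((S.map i).symm x : ℝ)) (fun x => ((T.map i).symm x : ℝ))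
  have h4 := supDist_nonneg (fun x : ends β => endDeriv β (S.map i) x)
    (fun x : ends β => endDeriv β (T.map i) x)
  linarith

theorem abs_map_sub_le (S T : IFS k β) (i : Fin k) (x : unitInterval) :
    |(S.map i x : ℝ) - T.map i x| ≤ dist S T := by
  refine le_trans ?_ (termDist_le_dist S T i)
  simp only [termDist]
  have h1 := abs_nonneg (S.prob i - T.prob i)
  have h2 : |(S.map i x : ℝ) - T.map i x| ≤
      supDist (fun x => (S.map i x : ℝ)) (fun x => (T.map i x : ℝ)) :=
    le_ciSup (bddAbove_sub (bounded_coe (S.map i)) (bounded_coe (T.map i))) x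
  have h3 := supDist_nonneg (fun x => ((S.map i).symm x : ℝ)) (fun x => ((T.map i).symm x : ℝ))
  have h4 := supDist_nonneg (fun x : ends β => endDeriv β (S.map i) x)
    (fun x : ends β => endDeriv β (T.map i) x)
  linarith

theorem abs_symm_sub_le (S T : IFS k β) (i : Fin k) (x : unitInterval) :
    |((S.map i).symm x : ℝ) - (T.map i).symm x| ≤ dist S T := by
  refine le_trans ?_ (termDist_le_dist S T i)
  simp only [termDist]
  have h1 := abs_nonneg (S.prob i - T.prob i)
  have h2 := supDist_nonneg (fun x => (S.map i x : ℝ)) (fun x => (T.map i x : ℝ))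
  have h3 : |((S.map i).symm x : ℝ) - (T.map i).symm x| ≤
      supDist (fun x => ((S.map i).symm x : ℝ)) (fun x => ((T.map i).symm x : ℝ)) :=
    le_ciSup (bddAbove_sub (bounded_coe (S.map i).symm) (bounded_coe (T.map i).symm)) x
  have h4 := supDist_nonneg (fun x : ends β => endDeriv β (S.map i) x)
    (fun x : ends β => endDeriv β (T.map i) x)
  linarith

theorem abs_endDeriv_sub_le (S T : IFS k β) (i : Fin k) {x : ℝ} (hx : x ∈ ends β) :
    |endDeriv β (S.map i) x - endDeriv β (T.map i) x| ≤ dist S T := by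
  refine le_trans ?_ (termDist_le_dist S T i)
  simp only [termDist]
  have h1 := abs_nonneg (S.prob i - T.prob i)
  have h2 := supDist_nonneg (fun x => (S.map i x : ℝ)) (fun x => (T.map i x : ℝ))
  have h3 := supDist_nonneg (fun x => ((S.map i).symm x : ℝ)) (fun x => ((T.map i).symm x : ℝ))
  have h4 : |endDeriv β (S.map i) x - endDeriv β (T.map i) x| ≤
      supDist (fun x : ends β => endDeriv β (S.map i) x)
        (fun x : ends β => endDeriv β (T.map i) x) :=
    le_ciSup (bddAbove_sub (bounded_endDeriv (S.isCPlus i)) (bounded_endDeriv (T.isCPlus i)))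
      (⟨x, hx⟩ : ends β)
  linarith

/-! ### The Markov operator -/

theorem isProbabilityMeasure_markov (S : IFS k β) (μ : Measure unitInterval)
    [IsProbabilityMeasure μ] : IsProbabilityMeasure (markov S μ) := by
  constructor
  rw [markov_apply _ _ MeasurableSet.univ]
  simp [S.sum_ofReal_prob]

theorem lintegral_markov (S : IFS k β) (μ : Measure unitInterval) {f : unitInterval → ENNReal}
    (hf : Measurable f) :
    ∫⁻ x, f x ∂(markov S μ) = ∑ i, ENNReal.ofReal (S.prob i) * ∫⁻ x, f (S.map i x) ∂μ := by
  simp only [markov, lintegral_finsetSum_measure, lintegral_smul_measure, smul_eq_mul]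
  refine Finset.sum_congr rfl fun i _ => ?_
  rw [lintegral_map hf (S.map i).continuous.measurable]

theorem integral_markov (S : IFS k β) (μ : Measure unitInterval) [IsFiniteMeasure μ]
    {f : unitInterval → ℝ} (hf : Continuous f) :
    ∫ x, f x ∂(markov S μ) = ∑ i, S.prob i * ∫ x, f (S.map i x) ∂μ := by
  have hfin : ∀ i, IsFiniteMeasure (ENNReal.ofReal (S.prob i) • μ.map (S.map i)) := fun i =>
    Measure.smul_finite _ ENNReal.ofReal_ne_top
  rw [markov, integral_finsetSum_measure fun i _ =>
    (hf.integrable_of_hasCompactSupport (HasCompactSupport.of_compactSpace f))]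
  refine Finset.sum_congr rfl fun i _ => ?_
  rw [integral_smul_measure, integral_map (S.map i).continuous.measurable.aemeasurable
    hf.aestronglyMeasurable, ENNReal.toReal_ofReal (S.prob_nonneg i), smul_eq_mul]

/-- The dual of the Markov operator depends continuously on the system. -/
theorem tendsto_dual_markov {ι : Type*} {L : Filter ι} {T : ι → IFS k β} {S : IFS k β}
    (hT : Tendsto T L (𝓝 S)) {f : unitInterval → ℝ} (hf : Continuous f) :
    TendstoUniformly (fun n x => ∑ i, (T n).prob i * f ((T n).map i x))
      (fun x => ∑ i, S.prob i * f (S.map i x)) L := by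
  have hd : Tendsto (fun n => dist (T n) S) L (𝓝 0) := tendsto_iff_dist_tendsto_zero.1 hT
  have hmap : ∀ i, TendstoUniformly (fun n x => (T n).map i x) (fun x => S.map i x) L := by
    intro i
    rw [Metric.tendstoUniformly_iff]
    intro ε hε
    filter_upwards [hd.eventually (gt_mem_nhds hε)] with n hn x
    rw [dist_comm, Subtype.dist_eq, Real.dist_eq]
    exact (abs_map_sub_le _ _ _ _).trans_lt hn
  have huc : UniformContinuous f := CompactSpace.uniformContinuous_of_continuous hf
  obtain ⟨C, hC⟩ : ∃ C, ∀ x, |f x| ≤ C := by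
    obtain ⟨C, hC⟩ := isCompact_univ.exists_bound_of_continuousOn hf.continuousOn
    exact ⟨C, fun x => hC x (mem_univ x)⟩
  have hC0 : 0 ≤ C := (abs_nonneg _).trans (hC 0)
  rw [Metric.tendstoUniformly_iff]
  intro ε hε
  have hε2 : 0 < ε / (2 * (k + 1)) := by positivity
  have hmap' : ∀ᶠ n in L, ∀ i x, dist (f (S.map i x)) (f ((T n).map i x)) < ε / (2 * (k + 1)) :=
    eventually_all.2 fun i =>
      (Metric.tendstoUniformly_iff.1 (huc.comp_tendstoUniformly (hmap i))) _ hε2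
  have hε3 : 0 < ε / (2 * (k + 1) * (C + 1)) := by positivity
  filter_upwards [hmap', hd.eventually (gt_mem_nhds hε3)] with n hn hn' x
  rw [Real.dist_eq, ← Finset.sum_sub_distrib]
  have hi : ∀ i, |S.prob i * f (S.map i x) - (T n).prob i * f ((T n).map i x)| ≤
      ε / (k + 1) := by
    intro i
    have h1 : |(T n).prob i - S.prob i| ≤ ε / (2 * (k + 1) * (C + 1)) :=
      (abs_prob_sub_le _ _ _).trans hn'.le
    have h2 := (hn i x).le
    rw [Real.dist_eq] at h2
    have h3 : S.prob i ≤ 1 := by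
      rw [← S.prob_sum]
      exact Finset.single_le_sum (fun j _ => S.prob_nonneg j) (Finset.mem_univ i)
    have h4 : S.prob i * f (S.map i x) - (T n).prob i * f ((T n).map i x) =
      S.prob i * (f (S.map i x) - f ((T n).map i x)) -
        ((T n).prob i - S.prob i) * f ((T n).map i x) := by ring
    rw [h4]
    refine (abs_sub _ _).trans ?_
    rw [abs_mul, abs_mul, abs_of_nonneg (S.prob_nonneg i)]
    have h5 : S.prob i * |f (S.map i x) - f ((T n).map i x)| ≤ ε / (2 * (k + 1)) :=
      (mul_le_of_le_one_left (abs_nonneg _) h3).trans h2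
    have h6 : |(T n).prob i - S.prob i| * |f ((T n).map i x)| ≤
        ε / (2 * (k + 1) * (C + 1)) * (C + 1) :=
      mul_le_mul h1 ((hC _).trans (by linarith)) (abs_nonneg _) hε3.le
    have h7 : ε / (2 * (k + 1) * (C + 1)) * (C + 1) = ε / (2 * (k + 1)) := by
      field_simp
    have h8 : ε / (2 * ((k : ℝ) + 1)) + ε / (2 * (k + 1)) = ε / (k + 1) := by
      field_simp; norm_num
    linarith
  refine (Finset.abs_sum_le_sum_abs _ _).trans_lt ?_
  refine (Finset.sum_le_sum fun i _ => hi i).trans_lt ?_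
  rw [Finset.sum_const, Finset.card_univ, Fintype.card_fin, nsmul_eq_mul, mul_div_assoc',
    div_lt_iff₀ (by positivity)]
  nlinarith

/-- Limits of almost invariant measures are invariant. -/
theorem markov_eq_of_tendsto {ι : Type*} {L : Filter ι} [L.NeBot] {T : ι → IFS k β} {S : IFS k β}
    (hT : Tendsto T L (𝓝 S)) {ν : ι → ProbabilityMeasure unitInterval}
    {μ : ProbabilityMeasure unitInterval} (hν : Tendsto ν L (𝓝 μ))
    (h : ∀ f : unitInterval → ℝ, Continuous f →
      Tendsto (fun n => ∫ x, f x ∂(markov (T n) (ν n)) - ∫ x, f x ∂(ν n : Measure unitInterval))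
        L (𝓝 0)) :
    markov S (μ : Measure unitInterval) = μ := by
  have hfin : IsProbabilityMeasure (markov S (μ : Measure unitInterval)) :=
    isProbabilityMeasure_markov _ _
  refine ext_of_forall_integral_eq_of_IsFiniteMeasure fun f => ?_
  have hw : ∀ g : unitInterval → ℝ, Continuous g →
      Tendsto (fun n => ∫ x, g x ∂(ν n : Measure unitInterval)) L
        (𝓝 (∫ x, g x ∂(μ : Measure unitInterval))) := fun g hg =>
    ProbabilityMeasure.tendsto_iff_forall_integral_tendsto.1 hν
      (BoundedContinuousFunction.mkOfCompact ⟨g, hg⟩)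
  have hint : ∀ (μ : Measure unitInterval) [IsFiniteMeasure μ] (g : unitInterval → ℝ),
      Continuous g → Integrable g μ := fun μ _ g hg =>
    hg.integrable_of_hasCompactSupport (HasCompactSupport.of_compactSpace g)
  have hU : ∀ R : IFS k β, Continuous fun x => ∑ i, R.prob i * f (R.map i x) := fun R =>
    continuous_finsetSum _ fun i _ => (f.continuous.comp (R.map i).continuous).const_mul _
  have hmk : ∀ (R : IFS k β) (μ : Measure unitInterval) [IsFiniteMeasure μ],
      ∫ x, f x ∂(markov R μ) = ∫ x, ∑ i, R.prob i * f (R.map i x) ∂μ := by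
    intro R μ _
    rw [integral_markov R μ f.continuous, integral_finsetSum (f := fun i x => R.prob i * f (R.map i x)) _
      fun i _ => hint _ _ ((f.continuous.comp (R.map i).continuous).const_mul _)]
    exact Finset.sum_congr rfl fun i _ => (integral_const_mul _ _).symm
  rw [hmk]
  have h1 : Tendsto (fun n => ∫ x, (∑ i, (T n).prob i * f ((T n).map i x)) -
      (∑ i, S.prob i * f (S.map i x)) ∂(ν n : Measure unitInterval)) L (𝓝 0) := by
    rw [Metric.tendsto_nhds]
    intro ε hε
    filter_upwards [Metric.tendstoUniformly_iff.1 (tendsto_dual_markov hT f.continuous) (ε / 2)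
      (half_pos hε)] with n hn
    rw [dist_zero_right]
    refine (norm_integral_le_of_norm_le_const (C := ε / 2)
      (Eventually.of_forall fun x => ?_)).trans_lt ?_
    · have := (hn x).le
      rwa [dist_comm, Real.dist_eq] at this
    · simp [half_lt_self hε]
  have h2 := hw _ (hU S)
  have h3 := h f f.continuous
  have h4 := hw f f.continuous
  have h5 : Tendsto (fun n => ∫ x, f x ∂(ν n : Measure unitInterval)) L
      (𝓝 (∫ x, ∑ i, S.prob i * f (S.map i x) ∂(μ : Measure unitInterval))) := by
    have h6 := (h1.add h2).sub h3
    simp only [zero_add, sub_zero] at h6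
    refine h6.congr fun n => ?_
    rw [hmk, integral_sub (hint _ _ (hU _)) (hint _ _ (hU _))]
    ring
  exact tendsto_nhds_unique h5 h4

/-! ### Existence of invariant measures with controlled tails -/

/-- `V` is a Lyapunov function for `S` whose mean along every orbit of the midpoint is at most
`R`. -/
structure IsDrift (S : IFS k β) (V : unitInterval → ENNReal) (R : ENNReal) : Prop where
  measurable : Measurable V
  start_le : V ⟨1 / 2, by norm_num, by norm_num⟩ ≤ R
  step : ∃ l C : ENNReal, l * R + C ≤ R ∧
    ∀ x, ∑ i, ENNReal.ofReal (S.prob i) * V (S.map i x) ≤ l * V x + C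

/-- The distribution of the chain started at the midpoint after `n` steps. -/
def orbitMeasure (S : IFS k β) (n : ℕ) : Measure unitInterval :=
  (markov S)^[n] (Measure.dirac ⟨1 / 2, by norm_num, by norm_num⟩)

instance (S : IFS k β) (n : ℕ) : IsProbabilityMeasure (orbitMeasure S n) := by
  induction n with
  | zero => exact Measure.dirac.isProbabilityMeasure
  | succ n ih =>
    rw [orbitMeasure, Function.iterate_succ_apply']
    exact @isProbabilityMeasure_markov _ _ S _ ih

theorem IsDrift.lintegral_orbitMeasure_le {S : IFS k β} {V : unitInterval → ENNReal} {R : ENNReal}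
    (h : IsDrift S V R) (n : ℕ) : ∫⁻ x, V x ∂(orbitMeasure S n) ≤ R := by
  obtain ⟨l, C, hlC, hstep⟩ := h.step
  induction n with
  | zero => simpa [orbitMeasure, lintegral_dirac' _ h.measurable] using h.start_le
  | succ n ih =>
    rw [orbitMeasure, Function.iterate_succ_apply', lintegral_markov _ _ h.measurable]
    change ∑ i, ENNReal.ofReal (S.prob i) * ∫⁻ x, V (S.map i x) ∂(orbitMeasure S n) ≤ R
    have hm : ∀ i, Measurable fun x => V (S.map i x) := fun i =>
      h.measurable.comp (S.map i).continuous.measurable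
    calc _ = ∫⁻ x, ∑ i, ENNReal.ofReal (S.prob i) * V (S.map i x) ∂(orbitMeasure S n) := by
          rw [lintegral_finsetSum _ fun i _ => (hm i).const_mul _]
          exact Finset.sum_congr rfl fun i _ => (lintegral_const_mul _ (hm i)).symm
      _ ≤ ∫⁻ x, (l * V x + C) ∂(orbitMeasure S n) := lintegral_mono hstep
      _ = l * ∫⁻ x, V x ∂(orbitMeasure S n) + C := by
          rw [lintegral_add_right _ measurable_const, lintegral_const_mul _ h.measurable]
          simp
      _ ≤ R := le_trans (by gcongr) hlC

/-- The averages of the distributions of the chain. -/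
def cesaroMeasure (S : IFS k β) (n : ℕ) : Measure unitInterval :=
  ((n : ENNReal) + 1)⁻¹ • ∑ j ∈ Finset.range (n + 1), orbitMeasure S j

theorem cesaro_weight (n : ℕ) : ((n : ENNReal) + 1)⁻¹ * ((n : ENNReal) + 1) = 1 :=
  ENNReal.inv_mul_cancel (by simp) (by finiteness)

instance (S : IFS k β) (n : ℕ) : IsProbabilityMeasure (cesaroMeasure S n) := by
  constructor
  simp [cesaroMeasure, cesaro_weight]

theorem IsDrift.lintegral_cesaroMeasure_le {S : IFS k β} {V : unitInterval → ENNReal} {R : ENNReal}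
    (h : IsDrift S V R) (n : ℕ) : ∫⁻ x, V x ∂(cesaroMeasure S n) ≤ R := by
  rw [cesaroMeasure, lintegral_smul_measure, lintegral_finsetSum_measure, smul_eq_mul]
  calc _ ≤ ((n : ENNReal) + 1)⁻¹ * ∑ j ∈ Finset.range (n + 1), R := by
        gcongr with j; exact h.lintegral_orbitMeasure_le j
    _ = R := by
        rw [Finset.sum_const, Finset.card_range, nsmul_eq_mul, ← mul_assoc, Nat.cast_succ,
          cesaro_weight, one_mul]

theorem integral_cesaroMeasure (S : IFS k β) (n : ℕ) {f : unitInterval → ℝ} (hf : Continuous f) :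
    ∫ x, f x ∂(cesaroMeasure S n) =
      ((n : ℝ) + 1)⁻¹ * ∑ j ∈ Finset.range (n + 1), ∫ x, f x ∂(orbitMeasure S j) := by
  rw [cesaroMeasure, integral_smul_measure, integral_finsetSum_measure fun i _ =>
    (hf.integrable_of_hasCompactSupport (HasCompactSupport.of_compactSpace f)), smul_eq_mul]
  congr 1
  rw [ENNReal.toReal_inv, ENNReal.toReal_add (by finiteness) (by finiteness)]
  simp

theorem integral_markov_cesaroMeasure_sub (S : IFS k β) (n : ℕ) {f : unitInterval → ℝ}
    (hf : Continuous f) :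
    ∫ x, f x ∂(markov S (cesaroMeasure S n)) - ∫ x, f x ∂(cesaroMeasure S n) =
      ((n : ℝ) + 1)⁻¹ * (∫ x, f x ∂(orbitMeasure S (n + 1)) - ∫ x, f x ∂(orbitMeasure S 0)) := by
  rw [integral_markov _ _ hf, integral_cesaroMeasure S n hf, ← Finset.sum_range_sub
    (fun j => ∫ x, f x ∂(orbitMeasure S j)), Finset.sum_sub_distrib, mul_sub]
  congr 1
  have h1 : ∀ j, ∫ x, f x ∂(orbitMeasure S (j + 1)) =
      ∑ i, S.prob i * ∫ x, f (S.map i x) ∂(orbitMeasure S j) := fun j => by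
    rw [← integral_markov _ _ hf, orbitMeasure, Function.iterate_succ_apply']
    rfl
  simp only [h1]
  have h2 : ∀ i, ∫ x, f (S.map i x) ∂(cesaroMeasure S n) =
      ((n : ℝ) + 1)⁻¹ * ∑ j ∈ Finset.range (n + 1), ∫ x, f (S.map i x) ∂(orbitMeasure S j) :=
    fun i => integral_cesaroMeasure S n (hf.comp (S.map i).continuous)
  simp only [h2]
  rw [Finset.sum_comm, Finset.mul_sum]
  refine Finset.sum_congr rfl fun i _ => ?_
  rw [Finset.mul_sum, Finset.mul_sum, Finset.mul_sum]
  exact Finset.sum_congr rfl fun j _ => by ring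

theorem exists_markov_eq (S : IFS k β) : ∃ μ : Measure unitInterval, IsProbabilityMeasure μ ∧
    markov S μ = μ ∧ ∀ V R, IsDrift S V R → ∀ U : Set unitInterval, IsOpen U →
      ∀ M : ENNReal, M ≠ 0 → M ≠ ⊤ → (∀ x ∈ U, M ≤ V x) → μ U ≤ R / M := by
  set c : ℕ → ProbabilityMeasure unitInterval := fun n => ⟨cesaroMeasure S n, inferInstance⟩
  set L : Ultrafilter ℕ := hyperfilter ℕ
  obtain ⟨μ, -, hμ⟩ := isCompact_univ.ultrafilter_le_nhds (L.map c) (by simp)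
  have hμ : Tendsto c L (𝓝 μ) := hμ
  have hL : (L : Filter ℕ) ≤ atTop := by
    rw [← Nat.cofinite_eq_atTop]; exact hyperfilter_le_cofinite
  refine ⟨μ, inferInstance, ?_, fun V R hV U hU M hM0 hM hMV => ?_⟩
  · refine markov_eq_of_tendsto (T := fun _ => S) (L := (L : Filter ℕ)) tendsto_const_nhds hμ
      fun f hf => Tendsto.mono_left ?_ hL
    obtain ⟨C, hC⟩ := isCompact_univ.exists_bound_of_continuousOn hf.continuousOn
    have hb : ∀ j, |∫ x, f x ∂(orbitMeasure S j)| ≤ C := fun j => by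
      refine (norm_integral_le_of_norm_le_const (C := C)
        (Eventually.of_forall fun x => hC x (mem_univ x))).trans ?_
      simp
    have h0 : Tendsto (fun n : ℕ => ((n : ℝ) + 1)⁻¹ * (2 * C)) atTop (𝓝 0) := by
      simpa using (tendsto_one_div_add_atTop_nhds_zero_nat (𝕜 := ℝ)).mul_const (2 * C)
    refine squeeze_zero_norm (fun n => ?_) h0
    change ‖∫ x, f x ∂(markov S (cesaroMeasure S n)) - ∫ x, f x ∂(cesaroMeasure S n)‖ ≤ _
    rw [integral_markov_cesaroMeasure_sub S n hf, norm_mul, Real.norm_of_nonneg (by positivity)]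
    refine mul_le_mul_of_nonneg_left ?_ (by positivity)
    exact (abs_sub _ _).trans (by linarith [hb (n + 1), hb 0])
  · refine (ProbabilityMeasure.le_liminf_measure_open_of_tendsto hμ hU).trans ?_
    refine liminf_le_of_frequently_le' (Eventually.frequently (Eventually.of_forall fun n => ?_))
    refine (measure_mono (show U ⊆ {x | M ≤ V x} from hMV)).trans ?_
    rw [ENNReal.le_div_iff_mul_le (Or.inl hM0) (Or.inl hM), mul_comm]
    exact (mul_meas_ge_le_lintegral hV.measurable M).trans (hV.lintegral_cesaroMeasure_le n)

/-! ### The Lyapunov functions -/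

theorem exists_rpow_sum_lt_one {p a : Fin k → ℝ} (hp : ∑ i, p i = 1) (ha : ∀ i, 0 < a i)
    (h : 0 < ∑ i, p i * Real.log (a i)) :
    ∃ α > (0 : ℝ), ∃ η > (0 : ℝ), (∀ i, 0 < a i - η) ∧
      ∑ i, (p i + η) * (a i - η) ^ (-α) < 1 := by
  have hd : HasDerivAt (fun α : ℝ => ∑ i, p i * (a i) ^ (-α))
      (∑ i, p i * -Real.log (a i)) 0 := by
    refine HasDerivAt.fun_sum fun i _ => HasDerivAt.const_mul _ ?_
    have := (hasDerivAt_neg (0 : ℝ)).const_rpow (a := a i) (ha i)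
    simpa using this
  have hneg : ∑ i, p i * -Real.log (a i) < 0 := by
    simpa [mul_neg, Finset.sum_neg_distrib] using h
  have hlt : ∀ᶠ α in 𝓝[>] (0 : ℝ), ∑ i, p i * (a i) ^ (-α) < 1 := by
    have h1 := hd.hasDerivWithinAt (s := Ioi 0)
    have h2 := (hasDerivWithinAt_iff_tendsto_slope' self_notMem_Ioi).1 h1
    filter_upwards [h2.eventually (gt_mem_nhds hneg), self_mem_nhdsWithin] with α hα hα0
    rw [slope_def_field] at hα
    have hα0 : 0 < α := hα0
    rw [sub_zero, div_lt_iff₀ hα0, zero_mul] at hα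
    simpa [hp] using hα
  obtain ⟨α, hα, hα0⟩ := (hlt.and self_mem_nhdsWithin).exists
  refine ⟨α, hα0, ?_⟩
  have hc : ContinuousAt (fun η : ℝ => ∑ i, (p i + η) * (a i - η) ^ (-α)) 0 := by
    refine tendsto_finsetSum _ fun i _ => ?_
    refine ContinuousAt.mul (by fun_prop) ?_
    exact ContinuousAt.rpow_const (by fun_prop) (Or.inl (by simpa using (ha i).ne'))
  have h1 : ∀ᶠ η in 𝓝 (0 : ℝ), ∑ i, (p i + η) * (a i - η) ^ (-α) < 1 :=
    hc.eventually (gt_mem_nhds (by simpa using hα))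
  have h2 : ∀ᶠ η in 𝓝 (0 : ℝ), ∀ i, 0 < a i - η := eventually_all.2 fun i =>
    (show ContinuousAt (fun η : ℝ => a i - η) 0 by fun_prop).eventually
      (lt_mem_nhds (by simpa using ha i))
  obtain ⟨η, ⟨h1, h2⟩, h3⟩ :=
    (((h1.and h2).filter_mono nhdsWithin_le_nhds).and (self_mem_nhdsWithin (s := Ioi 0))).exists
  exact ⟨η, h3, h2, h1⟩

/-- A bound, depending only on the parameters, for the mean of the Lyapunov function `u ^ (-α)`. -/
theorem exists_isDrift {q b : Fin k → ℝ} {α δ : ℝ} (hq : ∀ i, 0 < q i) (hb : ∀ i, 0 < b i)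
    (hα : 0 < α) (hδ : 0 < δ) (hsum : ∑ i, q i * b i ^ (-α) < 1) :
    ∃ R : ENNReal, R ≠ ⊤ ∧ ∀ (S : IFS k β) (u : unitInterval → ℝ), Measurable u →
      u ⟨1 / 2, by norm_num, by norm_num⟩ = 1 / 2 → (∀ i, S.prob i ≤ q i) →
      (∀ i x, b i * min (u x) δ ≤ u (S.map i x)) →
      IsDrift S (fun x => ENNReal.ofReal (u x) ^ (-α)) R := by
  set l : ℝ := ∑ i, q i * b i ^ (-α)
  have hl0 : 0 ≤ l := Finset.sum_nonneg fun i _ => mul_nonneg (hq i).le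
    (Real.rpow_nonneg (hb i).le _)
  set C : ℝ := l * δ ^ (-α)
  have hC0 : 0 ≤ C := mul_nonneg hl0 (Real.rpow_nonneg hδ.le _)
  set r : ℝ := max ((1 / 2 : ℝ) ^ (-α)) (C / (1 - l))
  have hr0 : 0 ≤ r := le_max_of_le_left (by positivity)
  refine ⟨ENNReal.ofReal r, ENNReal.ofReal_ne_top, fun S u hu hhalf hp hmap => ?_⟩
  have hmono : ∀ s t : ENNReal, s ≤ t → t ^ (-α) ≤ s ^ (-α) := fun s t hst =>
    by rw [ENNReal.rpow_neg, ENNReal.rpow_neg]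
       exact ENNReal.inv_le_inv.2 (ENNReal.rpow_le_rpow hst hα.le)
  refine ⟨by fun_prop, ?_, ENNReal.ofReal l, ENNReal.ofReal C, ?_, fun x => ?_⟩
  · rw [hhalf, ENNReal.ofReal_rpow_of_pos (by norm_num)]
    exact ENNReal.ofReal_le_ofReal (le_max_left _ _)
  · rw [← ENNReal.ofReal_mul hl0, ← ENNReal.ofReal_add (by positivity) hC0]
    refine ENNReal.ofReal_le_ofReal ?_
    have h1 : C / (1 - l) ≤ r := le_max_right _ _
    rw [div_le_iff₀ (by linarith)] at h1
    linarith
  · have key : ∀ i, ENNReal.ofReal (S.prob i) * ENNReal.ofReal (u (S.map i x)) ^ (-α) ≤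
        ENNReal.ofReal (q i * b i ^ (-α)) * ENNReal.ofReal (min (u x) δ) ^ (-α) := by
      intro i
      rw [ENNReal.ofReal_mul (hq i).le, ← ENNReal.ofReal_rpow_of_pos (hb i), mul_assoc,
        ← ENNReal.mul_rpow_of_ne_top ENNReal.ofReal_ne_top ENNReal.ofReal_ne_top,
        ← ENNReal.ofReal_mul (hb i).le]
      exact mul_le_mul' (ENNReal.ofReal_le_ofReal (hp i))
        (hmono _ _ (ENNReal.ofReal_le_ofReal (hmap i x)))
    refine (Finset.sum_le_sum fun i _ => key i).trans ?_
    rw [← Finset.sum_mul, ← ENNReal.ofReal_sum_of_nonneg fun i _ =>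
      mul_nonneg (hq i).le (Real.rpow_nonneg (hb i).le _)]
    change ENNReal.ofReal l * _ ≤ _
    rcases le_total (u x) δ with h | h
    · rw [min_eq_left h]; exact le_self_add
    · rw [min_eq_right h, ENNReal.ofReal_rpow_of_pos hδ, ← ENNReal.ofReal_mul hl0]
      exact le_add_self

/-! ### Mean value inequalities near the endpoints -/

theorem extendReal_coe (g : unitInterval → unitInterval) (x : unitInterval) :
    extendReal g x = g x := by
  simp [extendReal, projIcc_val]

theorem IsCPlus.mul_sub_le {g : unitInterval → unitInterval} (hg : IsCPlus β g) {c d m : ℝ}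
    (hcd : Icc c d ⊆ ends β) (h : ∀ z ∈ Ioo c d, m ≤ endDeriv β g z) {x y : ℝ}
    (hx : x ∈ Icc c d) (hy : y ∈ Icc c d) (hxy : x ≤ y) :
    m * (y - x) ≤ extendReal g y - extendReal g x := by
  have hnhds : ∀ z ∈ Ioo c d, ends β ∈ 𝓝 z := fun z hz =>
    mem_of_superset (isOpen_Ioo.mem_nhds hz) (Ioo_subset_Icc_self.trans hcd)
  refine (convex_Icc c d).mul_sub_le_image_sub_of_le_deriv (hg.contDiffOn.continuousOn.mono hcd)
    ?_ ?_ x hx y hy hxy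
  · rw [interior_Icc]
    intro z hz
    exact ((hg.contDiffOn.contDiffAt (hnhds z hz)).differentiableAt
      one_ne_zero).differentiableWithinAt
  · rw [interior_Icc]
    intro z hz
    rw [← derivWithin_of_mem_nhds (hnhds z hz)]
    exact h z hz

theorem IsCPlus.continuousOn_endDeriv (hβ : 0 < β) {g : unitInterval → unitInterval}
    (hg : IsCPlus β g) : ContinuousOn (endDeriv β g) (ends β) :=
  hg.contDiffOn.continuousOn_derivWithin (uniqueDiffOn_ends hβ) le_rfl

theorem zero_mem_ends (hβ : 0 < β) : (0 : ℝ) ∈ ends β := Or.inl ⟨le_rfl, hβ.le⟩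

theorem one_mem_ends (hβ : 0 < β) : (1 : ℝ) ∈ ends β := Or.inr ⟨by linarith, le_rfl⟩

theorem exists_forall_endDeriv_gt (hβ : 0 < β) (S : IFS k β) {e : ℝ} (he : e ∈ ends β) {η : ℝ}
    (hη : 0 < η) : ∃ δ > 0, ∀ i, ∀ x ∈ ends β, |x - e| ≤ δ →
      endDeriv β (S.map i) e - η < endDeriv β (S.map i) x := by
  have h : ∀ᶠ x in 𝓝[ends β] e, ∀ i, endDeriv β (S.map i) e - η < endDeriv β (S.map i) x :=
    eventually_all.2 fun i => ((S.isCPlus i).continuousOn_endDeriv hβ e he).eventually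
      (lt_mem_nhds (by linarith))
  obtain ⟨δ, hδ, hδ'⟩ := (nhdsWithin_hasBasis Metric.nhds_basis_closedBall _).eventually_iff.1 h
  exact ⟨δ, hδ, fun i x hx hxe => hδ' ⟨by rwa [Metric.mem_closedBall, Real.dist_eq], hx⟩ i⟩

theorem exists_lower_bound_zero (hβ : 0 < β) (S₀ : IFS k β) {η : ℝ}
    (hη : 0 < η) : ∃ δ > 0,
      ∀ᶠ S in 𝓝 S₀, ∀ i (x : unitInterval),
        (endDeriv β (S₀.map i) 0 - η) * min (x : ℝ) δ ≤ S.map i x := by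
  obtain ⟨δ, hδ, hd⟩ := exists_forall_endDeriv_gt hβ S₀ (zero_mem_ends hβ) (half_pos hη)
  refine ⟨min δ β, lt_min hδ hβ, ?_⟩
  filter_upwards [Metric.ball_mem_nhds S₀ (half_pos hη)] with S hS i x
  have hle : ∀ y : unitInterval, (y : ℝ) ≤ min δ β →
      (endDeriv β (S₀.map i) 0 - η) * y ≤ S.map i y := by
    intro y hy
    have hsub : Icc 0 (min δ β) ⊆ ends β := fun z hz =>
      Or.inl ⟨hz.1, hz.2.trans (min_le_right _ _)⟩
    have := (S.isCPlus i).mul_sub_le hsub (m := endDeriv β (S₀.map i) 0 - η) (fun z hz => by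
      have hz' := hsub (Ioo_subset_Icc_self hz)
      have h1 := hd i z hz' (by
        rw [sub_zero, abs_of_pos hz.1]; exact hz.2.le.trans (min_le_left _ _))
      have h2 := (abs_le.1 (abs_endDeriv_sub_le S S₀ i hz')).1
      rw [Metric.mem_ball] at hS
      linarith) (x := 0) (y := y) ⟨le_rfl, (lt_min hδ hβ).le⟩ ⟨y.2.1, hy⟩ y.2.1
    rw [extendReal_coe] at this
    have h0 : extendReal (S.map i) 0 = 0 := by
      have := extendReal_coe (S.map i) 0
      rw [(S.isCPlus i).map_zero] at this
      simpa using this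
    rw [h0] at this
    simpa using this
  rcases le_total (x : ℝ) (min δ β) with h | h
  · rw [min_eq_left h]; exact hle x h
  · rw [min_eq_right h]
    have h1 := (lt_min hδ hβ).le
    have hy : (⟨min δ β, h1, h.trans x.2.2⟩ : unitInterval) ≤ x := h
    exact (hle ⟨min δ β, h1, h.trans x.2.2⟩ le_rfl).trans ((S.isCPlus i).monotone hy)

theorem exists_lower_bound_one (hβ : 0 < β) (S₀ : IFS k β) {η : ℝ}
    (hη : 0 < η) : ∃ δ > 0,
      ∀ᶠ S in 𝓝 S₀, ∀ i (x : unitInterval),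
        (endDeriv β (S₀.map i) 1 - η) * min (1 - (x : ℝ)) δ ≤ 1 - S.map i x := by
  obtain ⟨δ, hδ, hd⟩ := exists_forall_endDeriv_gt hβ S₀ (one_mem_ends hβ) (half_pos hη)
  have hm : 0 < min δ β := lt_min hδ hβ
  refine ⟨min δ β, hm, ?_⟩
  filter_upwards [Metric.ball_mem_nhds S₀ (half_pos hη)] with S hS i x
  have hle : ∀ y : unitInterval, 1 - (y : ℝ) ≤ min δ β →
      (endDeriv β (S₀.map i) 1 - η) * (1 - y) ≤ 1 - S.map i y := by
    intro y hy
    have hsub : Icc (1 - min δ β) 1 ⊆ ends β := fun z hz =>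
      Or.inr ⟨by linarith [hz.1, min_le_right δ β], hz.2⟩
    have := (S.isCPlus i).mul_sub_le hsub (m := endDeriv β (S₀.map i) 1 - η) (fun z hz => by
      have hz' := hsub (Ioo_subset_Icc_self hz)
      have h1 := hd i z hz' (by
        rw [abs_sub_comm, abs_of_pos (by linarith [hz.2])]
        linarith [hz.1, min_le_left δ β])
      have h2 := (abs_le.1 (abs_endDeriv_sub_le S S₀ i hz')).1
      rw [Metric.mem_ball] at hS
      linarith) (x := y) (y := 1) ⟨by linarith, y.2.2⟩ ⟨by linarith, le_rfl⟩ y.2.2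
    rw [extendReal_coe] at this
    have h0 : extendReal (S.map i) 1 = 1 := by
      have := extendReal_coe (S.map i) 1
      rw [(S.isCPlus i).map_one] at this
      simpa using this
    rwa [h0] at this
  rcases le_total (1 - (x : ℝ)) (min δ β) with h | h
  · rw [min_eq_left h]; exact hle x h
  · rw [min_eq_right h]
    have hy : x ≤ (⟨1 - min δ β, by linarith [x.2.1], by linarith⟩ : unitInterval) :=
      Subtype.coe_le_coe.1 (show (x : ℝ) ≤ 1 - min δ β by linarith)
    have h1 := hle ⟨1 - min δ β, by linarith [x.2.1], by linarith⟩ (by simp)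
    have h2 : ((S.map i x : unitInterval) : ℝ) ≤ _ := (S.isCPlus i).monotone hy
    simp only [sub_sub_cancel] at h1
    linarith

/-- Systems close to an admissible one have invariant measures with uniformly small tails. -/
theorem IsAdmissible.exists_tail_bound (hβ : 0 < β) {S₀ : IFS k β}
    (h : IsAdmissible S₀) : ∃ φ : ℝ → ENNReal, Tendsto φ (𝓝[>] 0) (𝓝 0) ∧
      ∀ᶠ S in 𝓝 S₀, ∃ μ : Measure unitInterval, IsProbabilityMeasure μ ∧ markov S μ = μ ∧
        ∀ r > 0, μ {x | (x : ℝ) < r} ≤ φ r ∧ μ {x | 1 - r < (x : ℝ)} ≤ φ r := by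
  obtain ⟨α₀, hα₀, η₀, hη₀, hb₀, hs₀⟩ :=
    exists_rpow_sum_lt_one S₀.prob_sum h.deriv_zero_pos h.lyapunov_zero_pos
  obtain ⟨α₁, hα₁, η₁, hη₁, hb₁, hs₁⟩ :=
    exists_rpow_sum_lt_one S₀.prob_sum h.deriv_one_pos h.lyapunov_one_pos
  obtain ⟨δ₀, hδ₀, hl₀⟩ := exists_lower_bound_zero hβ S₀ hη₀
  obtain ⟨δ₁, hδ₁, hl₁⟩ := exists_lower_bound_one hβ S₀ hη₁
  obtain ⟨R₀, hR₀, hd₀⟩ := exists_isDrift (β := β) (q := fun i => S₀.prob i + η₀)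
    (fun i => by linarith [h.prob_pos i]) hb₀ hα₀ hδ₀ hs₀
  obtain ⟨R₁, hR₁, hd₁⟩ := exists_isDrift (β := β) (q := fun i => S₀.prob i + η₁)
    (fun i => by linarith [h.prob_pos i]) hb₁ hα₁ hδ₁ hs₁
  have hten : ∀ (R : ENNReal) (α : ℝ), R ≠ ⊤ → 0 < α →
      Tendsto (fun r : ℝ => R * ENNReal.ofReal r ^ α) (𝓝[>] 0) (𝓝 0) := by
    intro R α hR hα
    have h1 : Tendsto (fun r : ℝ => ENNReal.ofReal r ^ α) (𝓝 0) (𝓝 0) := by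
      have : Continuous fun r : ℝ => ENNReal.ofReal r ^ α :=
        ENNReal.continuous_rpow_const.comp ENNReal.continuous_ofReal
      simpa [hα] using this.tendsto 0
    simpa using ENNReal.Tendsto.const_mul (h1.mono_left nhdsWithin_le_nhds) (Or.inr hR)
  refine ⟨fun r => R₀ * ENNReal.ofReal r ^ α₀ + R₁ * ENNReal.ofReal r ^ α₁, ?_, ?_⟩
  · simpa using (hten R₀ α₀ hR₀ hα₀).add (hten R₁ α₁ hR₁ hα₁)
  have hbound : ∀ (μ : Measure unitInterval) (R : ENNReal) (α r : ℝ) (u : unitInterval → ℝ),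
      0 < α → 0 < r → IsOpen {x | u x < r} →
      (∀ U : Set unitInterval, IsOpen U → ∀ M : ENNReal, M ≠ 0 → M ≠ ⊤ →
        (∀ x ∈ U, M ≤ ENNReal.ofReal (u x) ^ (-α)) → μ U ≤ R / M) →
      μ {x | u x < r} ≤ R * ENNReal.ofReal r ^ α := by
    intro μ R α r u hα hr hopen hU
    have h0 : ENNReal.ofReal r ≠ 0 := by simpa using hr
    have h1 := hU _ hopen (ENNReal.ofReal r ^ (-α)) (by
      simp [ENNReal.rpow_eq_zero_iff, h0]) (by
      simp [ENNReal.rpow_eq_top_iff, hr]) (fun x hx => by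
        have hx : u x < r := hx
        rw [ENNReal.rpow_neg, ENNReal.rpow_neg]
        exact ENNReal.inv_le_inv.2 (ENNReal.rpow_le_rpow (ENNReal.ofReal_le_ofReal hx.le) hα.le))
    rwa [ENNReal.rpow_neg, div_eq_mul_inv, inv_inv] at h1
  filter_upwards [hl₀, hl₁, Metric.ball_mem_nhds S₀ hη₀, Metric.ball_mem_nhds S₀ hη₁] with
    S hS0 hS1 hball0 hball1
  rw [Metric.mem_ball] at hball0 hball1
  obtain ⟨μ, hμ, hinv, hdr⟩ := exists_markov_eq S
  refine ⟨μ, hμ, hinv, fun r hr => ⟨?_, ?_⟩⟩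
  · refine (hbound μ R₀ α₀ r (fun x => x) hα₀ hr
      (isOpen_lt continuous_subtype_val continuous_const)
      (hdr _ R₀ (hd₀ S (fun x => x) measurable_subtype_coe rfl (fun i => ?_) hS0))).trans
        le_self_add
    linarith [(abs_le.1 (abs_prob_sub_le S S₀ i)).2]
  · have h1 := hbound μ R₁ α₁ r (fun x => 1 - x) hα₁ hr
      (isOpen_lt (by fun_prop) continuous_const)
      (hdr _ R₁ (hd₁ S (fun x => 1 - x) (by fun_prop) (by norm_num) (fun i => by
        linarith [(abs_le.1 (abs_prob_sub_le S S₀ i)).2]) hS1))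
    refine (measure_mono fun x hx => ?_).trans (h1.trans le_add_self)
    have hx : 1 - r < (x : ℝ) := hx
    change 1 - (x : ℝ) < r
    linarith

/-- An invariant measure with vanishing tails is stationary in `(0,1)`. -/
theorem isStationary_of_tail {S : IFS k β} {μ : Measure unitInterval} [hμ : IsProbabilityMeasure μ]
    (h : markov S μ = μ) {φ : ℝ → ENNReal} (hφ : Tendsto φ (𝓝[>] 0) (𝓝 0))
    (htail : ∀ r > 0, μ {x | (x : ℝ) < r} ≤ φ r ∧ μ {x | 1 - r < (x : ℝ)} ≤ φ r) :
    IsStationary S μ := by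
  refine ⟨hμ, ?_, h⟩
  rw [← prob_compl_eq_zero_iff measurableSet_Ioo]
  have hsub : ∀ r > (0 : ℝ), (Ioo (0 : unitInterval) 1)ᶜ ⊆
      {x : unitInterval | (x : ℝ) < r} ∪ {x : unitInterval | 1 - r < (x : ℝ)} := by
    intro r hr x hx
    by_cases h0 : 0 < x
    · have h1 : x = 1 := le_antisymm unitInterval.le_one' (not_lt.1 fun hlt => hx ⟨h0, hlt⟩)
      right
      simp [h1, hr]
    · left
      have : x = 0 := le_antisymm (not_lt.1 h0) unitInterval.nonneg'
      simpa [this] using hr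
  refine le_antisymm (ge_of_tendsto (by simpa using hφ.add hφ) ?_) bot_le
  filter_upwards [self_mem_nhdsWithin] with r hr
  exact (measure_mono (hsub r hr)).trans ((measure_union_le _ _).trans
    (add_le_add (htail r hr).1 (htail r hr).2))

theorem IsAdmissible.exists_isStationary (hβ : 0 < β) {S : IFS k β}
    (h : IsAdmissible S) : ∃ μ, IsStationary S μ := by
  obtain ⟨φ, hφ, hev⟩ := h.exists_tail_bound hβ
  obtain ⟨μ, hμ, hinv, htail⟩ := hev.self_of_nhds
  exact ⟨μ, isStationary_of_tail hinv hφ htail⟩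

/-- The mass that the stationary distribution gives to an open set is lower semicontinuous on the
set of admissible systems. -/
theorem IsAdmissible.eventually_lt_measure (hβ : 0 < β) {S₀ : IFS k β}
    (h : IsAdmissible S₀) {V : Set unitInterval} (hV : IsOpen V) {c : ENNReal}
    (hc : ∀ μ, IsStationary S₀ μ → c < μ V) :
    ∀ᶠ S in 𝓝 S₀, IsAdmissible S → ∀ μ, IsStationary S μ → c < μ V := by
  obtain ⟨φ, hφ, hev⟩ := h.exists_tail_bound hβ
  by_contra hcon
  have hfreq := (not_eventually.1 hcon).and_eventually hev
  obtain ⟨T, hT, hTn⟩ := exists_seq_forall_of_frequently hfreq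
  have hν : ∀ n, ∃ ν : ProbabilityMeasure unitInterval, markov (T n) (ν : Measure _) = ν ∧
      (ν : Measure _) V ≤ c ∧ ∀ r > 0, (ν : Measure _) {x : unitInterval | (x : ℝ) < r} ≤ φ r ∧
        (ν : Measure _) {x : unitInterval | 1 - r < (x : ℝ)} ≤ φ r := by
    intro n
    obtain ⟨h1, μ, hμ, hinv, htail⟩ := hTn n
    push Not at h1
    obtain ⟨hadm, ν, hst, hle⟩ := h1
    have := (isStationary_of_tail hinv hφ htail).unique hst hadm.prob_pos hadm.movesRight
    subst this
    exact ⟨⟨μ, hμ⟩, hinv, hle, htail⟩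
  choose ν hinv hle htail using hν
  set L : Ultrafilter ℕ := hyperfilter ℕ
  obtain ⟨μ, -, hμ⟩ := isCompact_univ.ultrafilter_le_nhds (L.map ν) (by simp)
  have hμ : Tendsto ν L (𝓝 μ) := hμ
  have hL : (L : Filter ℕ) ≤ atTop := by
    rw [← Nat.cofinite_eq_atTop]; exact hyperfilter_le_cofinite
  have hlim : ∀ (U : Set unitInterval) (d : ENNReal), IsOpen U → (∀ n, (ν n : Measure _) U ≤ d) →
      (μ : Measure _) U ≤ d := fun U d hU hd =>
    (ProbabilityMeasure.le_liminf_measure_open_of_tendsto hμ hU).trans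
      (liminf_le_of_frequently_le' (Eventually.frequently (Eventually.of_forall hd)))
  have hmk : markov S₀ (μ : Measure _) = μ := by
    refine markov_eq_of_tendsto (hT.mono_left hL) hμ fun f _ => ?_
    simp only [hinv, sub_self]
    exact tendsto_const_nhds
  have hst : IsStationary S₀ (μ : Measure _) := isStationary_of_tail hmk hφ fun r hr =>
    ⟨hlim _ _ (isOpen_lt continuous_subtype_val continuous_const) fun n => (htail n r hr).1,
      hlim _ _ (isOpen_lt continuous_const continuous_subtype_val) fun n => (htail n r hr).2⟩
  exact absurd (hc _ hst) (not_lt.2 (hlim V c hV hle))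

/-! ### Reduction of genericity to a density statement -/

theorem mem_residual_of_isOpen {X : Type*} [TopologicalSpace X] {F O : Set X} (hO : IsOpen O)
    (h : F ⊆ closure (F ∩ O)) : {x : closure F | (x : X) ∈ O} ∈ residual (closure F) := by
  refine residual_of_dense_open (hO.preimage continuous_subtype_val) ?_
  rw [Subtype.dense_iff]
  refine closure_minimal (h.trans (closure_mono ?_)) isClosed_closure
  rintro x ⟨hxF, hxO⟩
  exact ⟨⟨x, subset_closure hxF⟩, hxO, rfl⟩

theorem continuous_map_uncurry (i : Fin k) :
    Continuous fun z : IFS k β × unitInterval => z.1.map i z.2 := by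
  rw [continuous_iff_continuousAt]
  rintro ⟨S, x⟩
  have h1 : Tendsto (fun z : IFS k β × unitInterval =>
      dist z.1 S + dist (S.map i z.2) (S.map i x)) (𝓝 (S, x)) (𝓝 0) := by
    have : Continuous fun z : IFS k β × unitInterval =>
      dist z.1 S + dist (S.map i z.2) (S.map i x) := by fun_prop
    simpa using this.tendsto (S, x)
  refine tendsto_iff_dist_tendsto_zero.2 (squeeze_zero (fun _ => dist_nonneg) (fun z => ?_) h1)
  refine (dist_triangle _ (S.map i z.2) _).trans (add_le_add_left ?_ _)
  rw [Subtype.dist_eq, Real.dist_eq]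
  exact abs_map_sub_le _ _ _ _

theorem continuous_prob (i : Fin k) : Continuous fun S : IFS k β => S.prob i := by
  refine continuous_iff_continuousAt.2 fun S => tendsto_iff_dist_tendsto_zero.2
    (squeeze_zero (fun _ => dist_nonneg) (fun T => ?_) (tendsto_iff_dist_tendsto_zero.1 tendsto_id))
  exact abs_prob_sub_le T S i

theorem continuous_endDeriv (i : Fin k) {x : ℝ} (hx : x ∈ ends β) :
    Continuous fun S : IFS k β => endDeriv β (S.map i) x := by
  refine continuous_iff_continuousAt.2 fun S => tendsto_iff_dist_tendsto_zero.2
    (squeeze_zero (fun _ => dist_nonneg) (fun T => ?_) (tendsto_iff_dist_tendsto_zero.1 tendsto_id))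
  exact abs_endDeriv_sub_le T S i hx

theorem isOpen_lyapunov_pos {x : ℝ} (hx : x ∈ ends β) :
    IsOpen {S : IFS k β | (∀ i, 0 < endDeriv β (S.map i) x) ∧
      0 < ∑ i, S.prob i * Real.log (endDeriv β (S.map i) x)} := by
  rw [isOpen_iff_mem_nhds]
  rintro S ⟨h1, h2⟩
  have h3 : ContinuousAt
      (fun S : IFS k β => ∑ i, S.prob i * Real.log (endDeriv β (S.map i) x)) S :=
    tendsto_finsetSum _ fun i _ => (continuous_prob i).continuousAt.mul
      ((continuous_endDeriv i hx).continuousAt.log (h1 i).ne')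
  exact (eventually_all.2 fun i => (continuous_endDeriv i hx).continuousAt.eventually
    (lt_mem_nhds (h1 i))).and (h3.eventually (lt_mem_nhds h2))

theorem isOpen_forall_moves {K : Set unitInterval} (hK : IsCompact K) :
    IsOpen {S : IFS k β | ∀ x ∈ K, ∃ i j, S.map i x < x ∧ x < S.map j x} := by
  rw [isOpen_iff_mem_nhds]
  intro S hS
  refine hK.eventually_forall_of_forall_eventually
    (P := fun (S : IFS k β) x => ∃ i j, S.map i x < x ∧ x < S.map j x) fun x hx => ?_
  obtain ⟨i, j, hi, hj⟩ := hS x hx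
  have h1 : ∀ᶠ z : IFS k β × unitInterval in 𝓝 (S, x), z.1.map i z.2 < z.2 :=
    ((continuous_map_uncurry i).continuousAt).eventually_lt continuous_snd.continuousAt hi
  have h2 : ∀ᶠ z : IFS k β × unitInterval in 𝓝 (S, x), z.2 < z.1.map j z.2 :=
    continuous_snd.continuousAt.eventually_lt ((continuous_map_uncurry j).continuousAt) hj
  filter_upwards [h1, h2] with z hz1 hz2 using ⟨i, j, hz1, hz2⟩

/-- A generic system in the closure of a set of admissible systems is admissible. -/
theorem eventually_residual_isAdmissible (hβ : 0 < β) {F : Set (IFS k β)}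
    (hF : ∀ S ∈ F, IsAdmissible S) :
    ∀ᶠ S : closure F in residual (closure F), IsAdmissible (S : IFS k β) := by
  have hopen : ∀ O : Set (IFS k β), IsOpen O → (∀ S ∈ F, S ∈ O) →
      ∀ᶠ S : closure F in residual (closure F), (S : IFS k β) ∈ O := fun O hO h =>
    mem_residual_of_isOpen hO fun S hS => subset_closure ⟨hS, h S hS⟩
  have h1 := hopen {S | ∀ i, 0 < S.prob i}
    (by
      simp only [ofPred_forall]
      exact isOpen_iInter_of_finite fun i => isOpen_lt continuous_const (continuous_prob i))
    fun S hS => (hF S hS).prob_pos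
  have h2 := hopen _ (isOpen_lyapunov_pos (zero_mem_ends hβ)) fun S hS =>
    ⟨(hF S hS).deriv_zero_pos, (hF S hS).lyapunov_zero_pos⟩
  have h3 := hopen _ (isOpen_lyapunov_pos (one_mem_ends hβ)) fun S hS =>
    ⟨(hF S hS).deriv_one_pos, (hF S hS).lyapunov_one_pos⟩
  have hK : ∀ n : ℕ, IsCompact {x : unitInterval | 1 / ((n : ℝ) + 1) ≤ x ∧
      (x : ℝ) ≤ 1 - 1 / ((n : ℝ) + 1)} := fun n =>
    ((isClosed_le continuous_const continuous_subtype_val).inter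
      (isClosed_le continuous_subtype_val continuous_const)).isCompact
  have hpos : ∀ n : ℕ, 0 < 1 / ((n : ℝ) + 1) := fun n => by positivity
  have h4 := eventually_countable_forall.2 fun n : ℕ =>
    hopen _ (isOpen_forall_moves (hK n)) fun S hS x hx => (hF S hS).moves x
      (Subtype.coe_lt_coe.1 ((hpos n).trans_le hx.1))
      (Subtype.coe_lt_coe.1 (hx.2.trans_lt (by
        change (1 : ℝ) - _ < 1
        linarith [hpos n])))
  filter_upwards [h1, h2, h3, h4] with S h1 h2 h3 h4
  refine ⟨h1, fun x hx0 hx1 => ?_, h2.1, h3.1, h2.2, h3.2⟩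
  have hx0' : (0 : ℝ) < x := hx0
  have hx1' : (x : ℝ) < 1 := hx1
  obtain ⟨n, hn⟩ := exists_nat_one_div_lt (lt_min hx0' (sub_pos.2 hx1'))
  rw [lt_min_iff] at hn
  exact h4 n x ⟨hn.1.le, by linarith [hn.2]⟩

/-- A measure that is concentrated, up to arbitrarily small mass, on open sets of arbitrarily small
measure is singular. -/
theorem mutuallySingular_of_forall_isOpen {α : Type*} [MeasurableSpace α] [TopologicalSpace α]
    [OpensMeasurableSpace α] {μ ν : Measure α} [IsProbabilityMeasure μ]
    (h : ∀ n : ℕ, ∃ V : Set α, IsOpen V ∧ ν V < 2⁻¹ ^ n ∧ 1 - 2⁻¹ ^ n < μ V) : μ ⟂ₘ ν := by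
  choose V hV hν hμ using h
  have hsum : ∑' n : ℕ, (2⁻¹ : ENNReal) ^ n ≠ ⊤ := by
    rw [ENNReal.tsum_geometric]; simp
  have h1 : ν (limsup V atTop) = 0 :=
    measure_limsup_atTop_eq_zero (ne_top_of_le_ne_top hsum (ENNReal.tsum_le_tsum fun n => (hν n).le))
  have h2 : μ (limsup (fun n => (V n)ᶜ) atTop) = 0 := by
    refine measure_limsup_atTop_eq_zero (ne_top_of_le_ne_top hsum (ENNReal.tsum_le_tsum fun n => ?_))
    rw [prob_compl_eq_one_sub (hV n).measurableSet]
    exact tsub_le_iff_tsub_le.1 (hμ n).le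
  have hmeas : MeasurableSet (limsup V atTop) :=
    MeasurableSet.measurableSet_limsup fun n => (hV n).measurableSet
  refine ⟨(limsup V atTop)ᶜ, hmeas.compl, ?_, by rwa [compl_compl]⟩
  refine measure_mono_null (fun x hx => ?_) h2
  rw [mem_compl_iff, mem_limsup_iff_frequently_mem, not_frequently] at hx
  rw [mem_limsup_iff_frequently_mem]
  exact hx.frequently

/-- The stationary distributions of `S` are concentrated, up to mass `c`, on an open set of
Lebesgue measure less than `c`. -/
def HasConcentratedStationary (S : IFS k β) (c : ENNReal) : Prop :=
  ∃ V : Set unitInterval, IsOpen V ∧ volume V < c ∧ ∀ μ, IsStationary S μ → 1 - c < μ V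

theorem eventually_residual_hasUniqueSingularStationary (hβ : 0 < β)
    (hdense : ∀ S ∈ admissibleAC k β, ∀ ε > 0, ∀ c : ENNReal, c ≠ 0 →
      ∃ T ∈ admissibleAC k β, dist T S < ε ∧ HasConcentratedStationary T c) :
    ∀ᶠ S : closure (admissibleAC k β) in residual (closure (admissibleAC k β)),
      HasUniqueSingularStationary (S : IFS k β) := by
  have hc : ∀ n : ℕ, ∀ᶠ S : closure (admissibleAC k β) in residual (closure (admissibleAC k β)),
      (S : IFS k β) ∈ interior
        {S : IFS k β | IsAdmissible S → HasConcentratedStationary S (2⁻¹ ^ n)} := by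
    intro n
    refine mem_residual_of_isOpen isOpen_interior fun S hS => Metric.mem_closure_iff.2 fun ε hε => ?_
    obtain ⟨T, hT, hTS, V, hV, hvol, hst⟩ := hdense S hS ε hε (2⁻¹ ^ n) (by simp)
    refine ⟨T, ⟨hT, ?_⟩, by rwa [dist_comm]⟩
    rw [mem_interior_iff_mem_nhds]
    filter_upwards [hT.1.eventually_lt_measure hβ hV hst] with R hR hadm
    exact ⟨V, hV, hvol, hR hadm⟩
  filter_upwards [eventually_residual_isAdmissible hβ fun S (hS : S ∈ admissibleAC k β) => hS.1,
    eventually_countable_forall.2 hc] with S hadm hS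
  obtain ⟨μ, hμ⟩ := hadm.exists_isStationary hβ
  have := hμ.1
  refine ⟨μ, hμ, fun ν hν => hν.unique hμ hadm.prob_pos hadm.movesRight,
    mutuallySingular_of_forall_isOpen fun n => ?_⟩
  obtain ⟨V, hV, hvol, hst⟩ := interior_subset (hS n) hadm
  exact ⟨V, hV, hvol, hst μ hμ⟩

/-! ### Absolutely continuous maps and null sets -/

theorem monotone_extendReal {g : unitInterval → unitInterval} (hg : Monotone g) :
    Monotone (extendReal g) := fun _ _ h => hg (monotone_projIcc _ h)

theorem volume_map_symm_eq_withDensity {g : unitInterval ≃ₜ unitInterval} (hg : IsCPlus β g)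
    (hac : AbsolutelyContinuousOnInterval (extendReal g) 0 1) :
    (volume : Measure unitInterval).map g.symm =
      (volume : Measure unitInterval).withDensity fun x : unitInterval => ENNReal.ofReal (deriv (extendReal g) x) := by
  have hfin : IsFiniteMeasure ((volume : Measure unitInterval).map g.symm) := inferInstance
  refine Measure.ext_of_Iic _ _ fun x => ?_
  have hpre : g.symm ⁻¹' Iic x = Iic (g x) := by
    ext y
    simp only [mem_preimage, mem_Iic]
    rw [← (hg.monotone.strictMono_of_injective g.injective).le_iff_le, Homeomorph.apply_symm_apply]
  rw [Measure.map_apply g.symm.continuous.measurable measurableSet_Iic, hpre,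
    unitInterval.volume_Iic, withDensity_apply _ measurableSet_Iic]
  have hsub : uIcc 0 (x : ℝ) ⊆ uIcc 0 1 := by
    rw [uIcc_of_le x.2.1, uIcc_of_le zero_le_one]
    exact Icc_subset_Icc_right x.2.2
  have hint := (hac.mono hsub).intervalIntegrable_deriv
  have hftc := (hac.mono hsub).integral_deriv_eq_sub
  have h0 : extendReal g 0 = 0 := by
    have := extendReal_coe g 0
    rw [hg.map_zero] at this
    simpa using this
  rw [extendReal_coe, h0, sub_zero, intervalIntegral.integral_of_le x.2.1] at hftc
  rw [← hftc, ofReal_integral_eq_lintegral_ofReal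
    ((intervalIntegrable_iff_integrableOn_Ioc_of_le x.2.1).1 hint)
    (Eventually.of_forall fun y => (monotone_extendReal hg.monotone).deriv_nonneg)]
  have h1 : ∫⁻ y in Iic x, ENNReal.ofReal (deriv (extendReal g) y) =
      ∫⁻ y in Subtype.val '' (Iic x), ENNReal.ofReal (deriv (extendReal g) y) :=
    setLIntegral_subtype (s := unitInterval) measurableSet_Icc (Iic x)
      (fun y => ENNReal.ofReal (deriv (extendReal g) y))
  have h2 : (Subtype.val '' (Iic x) : Set ℝ) = Icc 0 (x : ℝ) := by
    ext y
    constructor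
    · rintro ⟨z, hz, rfl⟩
      exact ⟨z.2.1, hz⟩
    · rintro ⟨hy0, hy1⟩
      exact ⟨⟨y, hy0, hy1.trans x.2.2⟩, hy1, rfl⟩
  rw [h1, h2]
  exact setLIntegral_congr Ioc_ae_eq_Icc

theorem volume_image_eq_zero {g : unitInterval ≃ₜ unitInterval} (hg : IsCPlus β g)
    (hac : AbsolutelyContinuousOnInterval (extendReal g) 0 1) {E : Set unitInterval}
    (hE : volume E = 0) : volume (g '' E) = 0 := by
  have h := withDensity_absolutelyContinuous (volume : Measure unitInterval)
    (fun x : unitInterval => ENNReal.ofReal (deriv (extendReal g) x)) hE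
  rw [← volume_map_symm_eq_withDensity hg hac] at h
  rw [g.image_eq_preimage_symm]
  exact (g.symm.toMeasurableEquiv.map_apply E).symm.trans h

theorem IsStationary.measure_preimage_eq_zero {S : IFS k β} {μ : Measure unitInterval}
    (h : IsStationary S μ) (hp : ∀ i, 0 < S.prob i) {E : Set unitInterval} (hE : MeasurableSet E)
    (h0 : μ E = 0) (i : Fin k) : μ (S.map i ⁻¹' E) = 0 := by
  rw [h.apply hE, Finset.sum_eq_zero_iff] at h0
  have := h0 i (Finset.mem_univ i)
  rw [mul_eq_zero, ENNReal.ofReal_eq_zero] at this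
  exact this.resolve_left (not_le.2 (hp i))

/-- The points that are reached from `N` in at most `n` steps. -/
def forwardSet (S : IFS k β) (N : Set unitInterval) : ℕ → Set unitInterval
  | 0 => N
  | n + 1 => forwardSet S N n ∪ ⋃ i, (S.map i).symm ⁻¹' forwardSet S N n

theorem measurableSet_forwardSet (S : IFS k β) {N : Set unitInterval} (hN : MeasurableSet N)
    (n : ℕ) : MeasurableSet (forwardSet S N n) := by
  induction n with
  | zero => exact hN
  | succ n ih =>
    exact ih.union (MeasurableSet.iUnion fun i => (S.map i).symm.continuous.measurable ih)

/-- Pure type: a stationary distribution of an absolutely continuous system is singular or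
absolutely continuous. -/
theorem IsStationary.mutuallySingular_or_absolutelyContinuous {S : IFS k β}
    (hS : S ∈ admissibleAC k β) {μ : Measure unitInterval} (h : IsStationary S μ) :
    μ ⟂ₘ volume ∨ μ ≪ volume := by
  have := h.1
  obtain ⟨Z, hZ, hZs, hZv⟩ := Measure.mutuallySingular_singularPart μ volume
  set N := ⋃ n, forwardSet S Zᶜ n
  have hN : MeasurableSet N := MeasurableSet.iUnion fun n => measurableSet_forwardSet S hZ.compl n
  have hnull : volume N = 0 := by
    refine measure_iUnion_null fun n => ?_
    induction n with
    | zero => exact hZv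
    | succ n ih =>
      refine measure_union_null ih (measure_iUnion_null fun i => ?_)
      rw [← Homeomorph.image_eq_preimage_symm]
      exact volume_image_eq_zero (S.isCPlus i) (hS.2 i) ih
  have hinv : ∀ i, N ⊆ S.map i ⁻¹' N := by
    intro i x hx
    obtain ⟨n, hn⟩ := mem_iUnion.1 hx
    exact mem_iUnion.2 ⟨n + 1, Or.inr (mem_iUnion.2 ⟨i, by simpa using hn⟩)⟩
  rcases h.measure_eq_zero_or_one hS.1.prob_pos hS.1.movesRight hN hinv with h0 | h1
  · right
    refine (Measure.singularPart_eq_zero μ volume).1 ?_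
    rw [← Measure.measure_univ_eq_zero, ← union_compl_self Z]
    refine measure_union_null hZs (le_antisymm ?_ bot_le)
    refine ((Measure.singularPart_le μ volume) _).trans (le_trans (measure_mono ?_) h0.le)
    exact subset_iUnion (forwardSet S Zᶜ) 0
  · left
    exact ⟨Nᶜ, hN.compl, (prob_compl_eq_zero_iff hN).2 h1, by rwa [compl_compl]⟩

theorem hasConcentratedStationary_of_volume_lt (hβ : 0 < β) {S : IFS k β}
    (hS : S ∈ admissibleAC k β) {c : ENNReal} (hc : c ≠ 0)
    (h : ∀ B : Set unitInterval, MeasurableSet B → (∀ i, volume (S.map i '' B \ B) = 0) →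
      (∀ i A, MeasurableSet A → volume (S.map i '' A) = 0 → volume (A ∩ B) = 0) →
      volume B < c) : HasConcentratedStationary S c := by
  obtain ⟨μ, hμ⟩ := hS.1.exists_isStationary hβ
  have := hμ.1
  suffices ∃ B : Set unitInterval, MeasurableSet B ∧ volume B < c ∧ μ Bᶜ = 0 by
    obtain ⟨B, hB, hBc, hBμ⟩ := this
    obtain ⟨V, hBV, hV, hVc⟩ := B.exists_isOpen_lt_of_lt c hBc
    refine ⟨V, hV, hVc, fun ν hν => ?_⟩
    rw [hν.unique hμ hS.1.prob_pos hS.1.movesRight]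
    have h1 : μ V = 1 := (prob_compl_eq_zero_iff hV.measurableSet).1
      (measure_mono_null (compl_subset_compl.2 hBV) hBμ)
    rw [h1]
    exact ENNReal.sub_lt_self ENNReal.one_ne_top one_ne_zero hc
  rcases hμ.mutuallySingular_or_absolutelyContinuous hS with hsing | hac
  · obtain ⟨Z, hZ, hZμ, hZv⟩ := hsing
    exact ⟨Zᶜ, hZ.compl, by rw [hZv]; exact pos_iff_ne_zero.2 hc, by rwa [compl_compl]⟩
  · have hd := Measure.withDensity_rnDeriv_eq μ volume hac
    have hmeas := Measure.measurable_rnDeriv μ volume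
    set f := μ.rnDeriv volume
    have hB : MeasurableSet {x | f x ≠ 0} := (hmeas (measurableSet_singleton 0)).compl
    have hzero : ∀ E, μ E = 0 ↔ volume ({x | f x ≠ 0} ∩ E) = 0 := fun E => by
      conv_lhs => rw [← hd]
      exact withDensity_apply_eq_zero hmeas
    have hBμ : μ {x | f x ≠ 0}ᶜ = 0 := by
      rw [hzero, inter_compl_self, measure_empty]
    refine ⟨_, hB, h _ hB (fun i => ?_) (fun i A hA hA0 => ?_), hBμ⟩
    · have h1 := hμ.measure_preimage_eq_zero hS.1.prob_pos hB.compl hBμ i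
      rw [hzero] at h1
      refine measure_mono_null ?_ (volume_image_eq_zero (S.isCPlus i) (hS.2 i) h1)
      rintro _ ⟨⟨x, hx, rfl⟩, hx'⟩
      exact ⟨x, ⟨hx, hx'⟩, rfl⟩
    · have hA' : MeasurableSet (S.map i '' A) := by
        rw [Homeomorph.image_eq_preimage_symm]
        exact (S.map i).symm.continuous.measurable hA
      have h1 := hμ.measure_preimage_eq_zero hS.1.prob_pos hA' (hac hA0) i
      rwa [preimage_image_eq _ (S.map i).injective, hzero, inter_comm] at h1

/-! ### Volume estimates along backward orbits -/

theorem volume_eq_hausdorffMeasure (E : Set unitInterval) :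
    volume E = Measure.hausdorffMeasure 1 E := by
  rw [unitInterval.volume_apply, ← hausdorffMeasure_real,
    isometry_subtype_coe.hausdorffMeasure_image (Or.inl zero_le_one)]

theorem volume_le_of_expanding {g : unitInterval ≃ₜ unitInterval} {K : NNReal}
    (hg : LipschitzWith K g.symm) (E : Set unitInterval) : volume E ≤ K * volume (g '' E) := by
  have h := hg.hausdorffMeasure_image_le zero_le_one (g '' E)
  rw [← image_comp, show (g.symm ∘ g : unitInterval → unitInterval) = id from
    funext fun x => g.symm_apply_apply x, image_id] at h
  rw [volume_eq_hausdorffMeasure, volume_eq_hausdorffMeasure]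
  simpa using h

/-- The points from which `J` is reached in at most `n` steps. -/
def reachSet (S : IFS k β) (J : Set unitInterval) : ℕ → Set unitInterval
  | 0 => J
  | n + 1 => reachSet S J n ∪ ⋃ i, S.map i ⁻¹' reachSet S J n

theorem subset_reachSet (S : IFS k β) (J : Set unitInterval) (n : ℕ) : J ⊆ reachSet S J n := by
  induction n with
  | zero => exact subset_rfl
  | succ n ih => exact ih.trans subset_union_left

/-- If `T` agrees with `S` outside `J`, and `B` is invariant under `T`, then `B` is small on the
points that reach `J` as soon as it is small on `J`. -/
theorem volume_inter_reachSet_le {S T : IFS k β} {J B : Set unitInterval} {K : NNReal}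
    (hK : ∀ i, LipschitzWith K (S.map i).symm) (hST : ∀ i, ∀ x ∉ J, T.map i x = S.map i x)
    (hB : ∀ i, volume (T.map i '' B \ B) = 0) (n : ℕ) :
    volume (B ∩ reachSet S J n) ≤ (1 + k * K) ^ n * volume (B ∩ J) := by
  induction n with
  | zero => simp [reachSet]
  | succ n ih =>
    have hi : ∀ i, volume ((B ∩ S.map i ⁻¹' reachSet S J n) \ J) ≤
        K * volume (B ∩ reachSet S J n) := by
      intro i
      refine (volume_le_of_expanding (hK i) _).trans ?_
      refine mul_le_mul_right ?_ _
      calc volume (S.map i '' ((B ∩ S.map i ⁻¹' reachSet S J n) \ J))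
          ≤ volume (B ∩ reachSet S J n ∪ T.map i '' B \ B) := by
            refine measure_mono ?_
            rintro _ ⟨x, ⟨⟨hxB, hxO⟩, hxJ⟩, rfl⟩
            by_cases hx : S.map i x ∈ B
            · exact Or.inl ⟨hx, hxO⟩
            · exact Or.inr ⟨⟨x, hxB, hST i x hxJ⟩, hx⟩
        _ ≤ volume (B ∩ reachSet S J n) + volume (T.map i '' B \ B) := measure_union_le _ _
        _ = volume (B ∩ reachSet S J n) := by rw [hB i, add_zero]
    calc volume (B ∩ reachSet S J (n + 1))
        ≤ volume (B ∩ reachSet S J n ∪ ⋃ i, (B ∩ S.map i ⁻¹' reachSet S J n) \ J) := by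
          refine measure_mono ?_
          rintro x ⟨hxB, hx | hx⟩
          · exact Or.inl ⟨hxB, hx⟩
          · obtain ⟨i, hi⟩ := mem_iUnion.1 hx
            by_cases hxJ : x ∈ J
            · exact Or.inl ⟨hxB, subset_reachSet S J n hxJ⟩
            · exact Or.inr (mem_iUnion.2 ⟨i, ⟨hxB, hi⟩, hxJ⟩)
      _ ≤ volume (B ∩ reachSet S J n) + ∑ i : Fin k, K * volume (B ∩ reachSet S J n) :=
          (measure_union_le _ _).trans (add_le_add le_rfl
            ((measure_iUnion_fintype_le _ _).trans (Finset.sum_le_sum fun i _ => hi i)))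
      _ = (1 + k * K) * volume (B ∩ reachSet S J n) := by
          rw [Finset.sum_const, Finset.card_univ, Fintype.card_fin, nsmul_eq_mul]; ring
      _ ≤ (1 + k * K) ^ (n + 1) * volume (B ∩ J) := by
          rw [pow_succ', mul_assoc]; gcongr

/-! ### Building systems and comparing them -/

theorem ends_subset (hβ' : β < 1 / 2) : ends β ⊆ Icc 0 1 := by
  rintro x (hx | hx)
  · exact ⟨hx.1, by linarith [hx.2]⟩
  · exact ⟨by linarith [hx.1], hx.2⟩

theorem extendReal_of_mem (g : unitInterval → unitInterval) {x : ℝ} (hx : x ∈ Icc (0 : ℝ) 1) :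
    extendReal g x = g ⟨x, hx⟩ := extendReal_coe g ⟨x, hx⟩

/-- A strictly increasing continuous function fixing the endpoints is a homeomorphism. -/
theorem exists_homeomorph (hβ' : β < 1 / 2) {f : ℝ → ℝ} (h0 : f 0 = 0)
    (h1 : f 1 = 1) (hmono : StrictMonoOn f (Icc 0 1)) (hc : ContinuousOn f (Icc 0 1))
    (hd : ContDiffOn ℝ 1 f (ends β)) :
    ∃ h : unitInterval ≃ₜ unitInterval, IsCPlus β h ∧ (∀ x : unitInterval, (h x : ℝ) = f x) ∧
      EqOn (extendReal h) f (Icc 0 1) := by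
  have hmem : ∀ x : unitInterval, f x ∈ Icc (0 : ℝ) 1 := fun x => by
    constructor
    · rw [← h0]; exact hmono.monotoneOn ⟨le_rfl, zero_le_one⟩ x.2 x.2.1
    · rw [← h1]; exact hmono.monotoneOn x.2 ⟨zero_le_one, le_rfl⟩ x.2.2
  set F : unitInterval → unitInterval := fun x => ⟨f x, hmem x⟩
  have hF : StrictMono F := fun x y hxy => hmono x.2 y.2 hxy
  have hFc : Continuous F := (continuousOn_iff_continuous_domRestrict.1 hc).subtype_mk _
  have hF0 : F 0 = 0 := Subtype.ext (by simp [F, h0])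
  have hF1 : F 1 = 1 := Subtype.ext (by simp [F, h1])
  have hsurj : Function.Surjective F := fun y =>
    mem_range_of_exists_le_of_exists_ge hFc ⟨0, by rw [hF0]; exact unitInterval.nonneg'⟩
      ⟨1, by rw [hF1]; exact unitInterval.le_one'⟩
  set h : unitInterval ≃ₜ unitInterval := (hF.orderIsoOfSurjective F hsurj).toHomeomorph
  have hcoe : ∀ x, h x = F x := fun x => rfl
  have hext : EqOn (extendReal h) f (Icc 0 1) := fun x hx => by
    rw [extendReal_of_mem _ hx, hcoe]
  exact ⟨h, ⟨h.continuous, hF.monotone, hF0, hF1, hd.congr fun x hx => hext (ends_subset hβ' hx)⟩,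
    fun x => rfl, hext⟩

theorem endDeriv_eq (hβ : 0 < β) {g : unitInterval → unitInterval} {f : ℝ → ℝ} {d x : ℝ}
    (hgf : EqOn (extendReal g) f (ends β)) (hx : x ∈ ends β)
    (h : HasDerivWithinAt f d (ends β) x) : endDeriv β g x = d :=
  (h.congr hgf (hgf hx)).derivWithin (uniqueDiffOn_ends hβ x hx)

theorem IsCPlus.hasDerivWithinAt {g : unitInterval → unitInterval} (hg : IsCPlus β g) {x : ℝ}
    (hx : x ∈ ends β) : HasDerivWithinAt (extendReal g) (endDeriv β g x) (ends β) x :=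
  ((hg.contDiffOn x hx).differentiableWithinAt one_ne_zero).hasDerivWithinAt

theorem absolutelyContinuousOnInterval_congr {f g : ℝ → ℝ} {a b : ℝ}
    (hf : AbsolutelyContinuousOnInterval f a b) (h : EqOn g f (uIcc a b)) :
    AbsolutelyContinuousOnInterval g a b := by
  rw [absolutelyContinuousOnInterval_iff] at hf ⊢
  intro ε hε
  obtain ⟨δ, hδ, H⟩ := hf ε hε
  refine ⟨δ, hδ, fun E hE hlen => ?_⟩
  rw [Finset.sum_congr rfl fun i hi => by rw [h (hE.1 i hi).1, h (hE.1 i hi).2]]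
  exact H E hE hlen

theorem absolutelyContinuousOnInterval_comp {f g : ℝ → ℝ} {a b : ℝ}
    (hf : AbsolutelyContinuousOnInterval f a b) (hg : AbsolutelyContinuousOnInterval g a b)
    (hmono : Monotone g) (hmaps : MapsTo g (uIcc a b) (uIcc a b)) :
    AbsolutelyContinuousOnInterval (f ∘ g) a b := by
  rw [absolutelyContinuousOnInterval_iff] at hf hg ⊢
  intro ε hε
  obtain ⟨δ, hδ, H⟩ := hf ε hε
  obtain ⟨δ', hδ', H'⟩ := hg δ hδ
  refine ⟨δ', hδ', fun E hE hlen => ?_⟩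
  refine H (E.1, fun i => (g (E.2 i).1, g (E.2 i).2)) ⟨fun i hi => ?_, fun i hi j hj hij => ?_⟩
    (H' E hE hlen)
  · exact ⟨hmaps (hE.1 i hi).1, hmaps (hE.1 i hi).2⟩
  · have h1 := hE.2 hi hj hij
    simp only [Function.onFun, uIoc, Ioc_disjoint_Ioc] at h1 ⊢
    simp only [← hmono.map_min, ← hmono.map_max]
    exact hmono h1

/-- To be close to `S` it suffices to have the same weights, and maps and derivatives close to those
of `S`. -/
theorem IFS.exists_dist_lt (S : IFS k β) {ε : ℝ} (hε : 0 < ε) : ∃ e > 0, ∀ T : IFS k β,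
    T.prob = S.prob → (∀ i x, |(T.map i x : ℝ) - S.map i x| ≤ e) →
    (∀ i, ∀ x ∈ ends β, |endDeriv β (T.map i) x - endDeriv β (S.map i) x| ≤ e) →
    dist T S < ε := by
  set ε' := ε / (4 * (k + 1)) with hε'
  have hε'0 : 0 < ε' := by positivity
  have huc : ∀ i, ∃ e > 0, ∀ x y : unitInterval, dist x y < e →
      dist ((S.map i).symm x) ((S.map i).symm y) < ε' := fun i =>
    Metric.uniformContinuous_iff.1
      (CompactSpace.uniformContinuous_of_continuous (S.map i).symm.continuous) ε' hε'0 |>.imp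
        fun e he => ⟨he.1, fun x y h => he.2 h⟩
  choose e he hsymm using huc
  obtain ⟨e₀, he₀, he₀'⟩ : ∃ e₀ > 0, ∀ i, e₀ < e i := by
    have : ∀ᶠ x in 𝓝[>] (0 : ℝ), ∀ i, x < e i := eventually_all.2 fun i =>
      (gt_mem_nhds (he i)).filter_mono nhdsWithin_le_nhds
    obtain ⟨x, hx, hx0⟩ := (this.and self_mem_nhdsWithin).exists
    exact ⟨x, hx0, hx⟩
  refine ⟨min e₀ ε', lt_min he₀ hε'0, fun T hp hmap hder => ?_⟩
  have hi : ∀ i, termDist β (T.prob i) (S.prob i) (T.map i) (S.map i) ≤ 3 * ε' := by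
    intro i
    have h1 : supDist (fun x => (T.map i x : ℝ)) (fun x => (S.map i x : ℝ)) ≤ ε' :=
      Real.iSup_le (fun x => (hmap i x).trans (min_le_right _ _)) hε'0.le
    have h2 : supDist (fun x => ((T.map i).symm x : ℝ)) (fun x => ((S.map i).symm x : ℝ)) ≤ ε' := by
      refine Real.iSup_le (fun y => ?_) hε'0.le
      obtain ⟨x, rfl⟩ := (T.map i).surjective y
      have := hsymm i (T.map i x) (S.map i x) (by
        rw [Subtype.dist_eq, Real.dist_eq]
        exact (hmap i x).trans_lt ((min_le_left _ _).trans_lt (he₀' i)))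
      dsimp only
      rw [Homeomorph.symm_apply_apply] at this ⊢
      rw [Subtype.dist_eq, Real.dist_eq, abs_sub_comm] at this
      exact this.le
    have h3 : supDist (fun x : ends β => endDeriv β (T.map i) x)
        (fun x : ends β => endDeriv β (S.map i) x) ≤ ε' :=
      Real.iSup_le (fun x => (hder i x x.2).trans (min_le_right _ _)) hε'0.le
    simp only [termDist, hp, sub_self, abs_zero]
    linarith
  refine (Finset.sum_le_sum fun i _ => hi i).trans_lt ?_
  rw [Finset.sum_const, Finset.card_univ, Fintype.card_fin, nsmul_eq_mul, hε']
  have : (k : ℝ) * (3 * (ε / (4 * (k + 1)))) = ε * (3 * k / (4 * (k + 1))) := by field_simp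
  rw [this]
  refine mul_lt_of_lt_one_right hε ?_
  rw [div_lt_one (by positivity)]
  have : (0 : ℝ) ≤ k := k.cast_nonneg
  linarith

/-- `g` expands distances at least by the factor `t`. -/
def Expanding (t : ℝ) (g : unitInterval → unitInterval) : Prop :=
  ∀ x y : unitInterval, x ≤ y → t * ((y : ℝ) - x) ≤ g y - g x

theorem Expanding.lipschitzWith_symm {t : ℝ} (ht : 0 < t) {g : unitInterval ≃ₜ unitInterval}
    (hg : Expanding t g) : LipschitzWith (Real.toNNReal t⁻¹) g.symm := by
  refine LipschitzWith.of_dist_le_mul fun x y => ?_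
  have key : ∀ x y : unitInterval, x ≤ y → dist x y ≤ t⁻¹ * dist (g x) (g y) := by
    intro x y hxy
    have h1 := hg x y hxy
    have h2 : (x : ℝ) ≤ y := hxy
    rw [inv_mul_eq_div, le_div_iff₀ ht, dist_comm, Subtype.dist_eq, Real.dist_eq,
      abs_of_nonneg (sub_nonneg.2 h2), dist_comm, Subtype.dist_eq, Real.dist_eq, mul_comm]
    exact h1.trans (le_abs_self _)
  rw [Real.coe_toNNReal _ (inv_nonneg.2 ht.le)]
  have h3 : dist (g.symm x) (g.symm y) ≤ t⁻¹ * dist (g (g.symm x)) (g (g.symm y)) := by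
    rcases le_total (g.symm x) (g.symm y) with h | h
    · exact key _ _ h
    · rw [dist_comm, dist_comm (g (g.symm x))]; exact key _ _ h
  simpa using h3

theorem IsCPlus.extendReal_zero {g : unitInterval → unitInterval} (hg : IsCPlus β g) :
    extendReal g 0 = 0 := by
  have := extendReal_coe g 0
  rw [hg.map_zero] at this
  simpa using this

theorem IsCPlus.extendReal_one {g : unitInterval → unitInterval} (hg : IsCPlus β g) :
    extendReal g 1 = 1 := by
  have := extendReal_coe g 1
  rw [hg.map_one] at this
  simpa using this

theorem continuous_extendReal {g : unitInterval → unitInterval} (hg : Continuous g) :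
    Continuous (extendReal g) :=
  continuous_subtype_val.comp (hg.comp continuous_projIcc)

/-- Conditions that follow from closeness to an admissible system. -/
theorem IsAdmissible.exists_dist_lt (hβ : 0 < β) {S : IFS k β} (h : IsAdmissible S) :
    ∃ ε > 0, ∀ T : IFS k β, T.prob = S.prob → dist T S < ε →
      (∀ x : unitInterval, 0 < x → x < 1 → ∃ i j, T.map i x < x ∧ x < T.map j x) →
      IsAdmissible T := by
  have h0 := (isOpen_lyapunov_pos (k := k) (zero_mem_ends hβ)).mem_nhds
    (show S ∈ _ from ⟨h.deriv_zero_pos, h.lyapunov_zero_pos⟩)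
  have h1 := (isOpen_lyapunov_pos (k := k) (one_mem_ends hβ)).mem_nhds
    (show S ∈ _ from ⟨h.deriv_one_pos, h.lyapunov_one_pos⟩)
  obtain ⟨ε, hε, hsub⟩ := Metric.mem_nhds_iff.1 (inter_mem h0 h1)
  refine ⟨ε, hε, fun T hp hT hm => ?_⟩
  obtain ⟨⟨h2, h3⟩, h4, h5⟩ := hsub (show T ∈ Metric.ball S ε from hT)
  exact ⟨fun i => by rw [hp]; exact h.prob_pos i, hm, h2, h4, h3, h5⟩

/-- Absolutely continuous admissible systems with expanding maps are dense. -/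
theorem exists_expanding (hβ : 0 < β) (hβ' : β < 1 / 2) {S : IFS k β}
    (hS : S ∈ admissibleAC k β) {ε : ℝ} (hε : 0 < ε) :
    ∃ T ∈ admissibleAC k β, dist T S < ε ∧ ∃ t > 0, ∀ i, Expanding t (T.map i) := by
  obtain ⟨ε', hε', hadm⟩ := hS.1.exists_dist_lt hβ
  obtain ⟨e, he, hdist⟩ := S.exists_dist_lt (lt_min hε hε')
  obtain ⟨C, hC⟩ : ∃ C, ∀ i, ∀ x ∈ ends β, |endDeriv β (S.map i) x| ≤ C := by
    choose C hC using fun i => bounded_endDeriv (S.isCPlus i)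
    refine ⟨∑ i, |C i|, fun i x hx => (hC i ⟨x, hx⟩).trans ((le_abs_self _).trans ?_)⟩
    exact Finset.single_le_sum (f := fun i => |C i|) (fun _ _ => abs_nonneg _) (Finset.mem_univ i)
  have hC1 : 0 < 1 + |C| := by positivity
  obtain ⟨t, ht0, ht⟩ := exists_between (lt_min one_pos (div_pos he hC1))
  have ht1 : t < 1 := ht.trans_le (min_le_left _ _)
  have hte : t * (1 + |C|) ≤ e := ((lt_div_iff₀ hC1).1 (ht.trans_le (min_le_right _ _))).le
  set f : Fin k → ℝ → ℝ := fun i x => (1 - t) * extendReal (S.map i) x + t * x with hf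
  have hexp : ∀ i x y, x ≤ y → t * (y - x) ≤ f i y - f i x := by
    intro i x y hxy
    have h1 := monotone_extendReal (S.isCPlus i).monotone hxy
    have h2 : 0 ≤ (1 - t) * (extendReal (S.map i) y - extendReal (S.map i) x) :=
      mul_nonneg (by linarith) (by linarith)
    simp only [hf]
    nlinarith
  have hex := fun i => exists_homeomorph hβ' (f := f i)
    (by simp [hf, (S.isCPlus i).extendReal_zero]) (by simp [hf, (S.isCPlus i).extendReal_one])
    (fun x _ y _ hxy => by
      have := hexp i x y hxy.le
      have := mul_pos ht0 (sub_pos.2 hxy)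
      linarith)
    (((continuous_extendReal (S.isCPlus i).continuous).const_mul (1 - t)).add
      (continuous_id.const_mul t)).continuousOn
    ((contDiffOn_const.mul (S.isCPlus i).contDiffOn).add (contDiffOn_const.mul contDiffOn_id))
  choose g hg hgf hgext using hex
  set T : IFS k β := ⟨g, S.prob, hg, S.prob_nonneg, S.prob_sum⟩
  have hmapT : ∀ i x, (T.map i x : ℝ) = (1 - t) * S.map i x + t * x := fun i x => by
    rw [← extendReal_coe (S.map i)]; exact hgf i x
  have hTS : dist T S < min ε ε' := by
    refine hdist T rfl (fun i x => ?_) fun i x hx => ?_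
    · rw [hmapT, show (1 - t) * (S.map i x : ℝ) + t * x - S.map i x = t * (x - S.map i x) by ring,
        abs_mul, abs_of_pos ht0]
      refine le_trans (mul_le_mul_of_nonneg_left ?_ ht0.le) hte
      have h1 := (S.map i x).2
      have h2 := x.2
      rw [abs_le]
      constructor <;> linarith [h1.1, h1.2, h2.1, h2.2, abs_nonneg C]
    · have h1 : HasDerivWithinAt (f i) ((1 - t) * endDeriv β (S.map i) x + t * 1) (ends β) x :=
        (((S.isCPlus i).hasDerivWithinAt hx).const_mul (1 - t)).add
          ((hasDerivWithinAt_id x _).const_mul t)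
      rw [endDeriv_eq hβ ((hgext i).mono (ends_subset hβ')) hx h1,
        show (1 - t) * endDeriv β (S.map i) x + t * 1 - endDeriv β (S.map i) x =
          t * (1 - endDeriv β (S.map i) x) by ring, abs_mul, abs_of_pos ht0]
      refine le_trans (mul_le_mul_of_nonneg_left ?_ ht0.le) hte
      refine (abs_sub _ _).trans ?_
      rw [abs_one]
      linarith [hC i x hx, le_abs_self C]
  refine ⟨T, ⟨hadm T rfl (hTS.trans_le (min_le_right _ _)) fun x hx0 hx1 => ?_, fun i => ?_⟩,
    hTS.trans_le (min_le_left _ _), t, ht0, fun i x y hxy => ?_⟩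
  · obtain ⟨i, j, hi, hj⟩ := hS.1.moves x hx0 hx1
    have hi : (S.map i x : ℝ) < x := hi
    have hj : (x : ℝ) < S.map j x := hj
    refine ⟨i, j, Subtype.coe_lt_coe.1 ?_, Subtype.coe_lt_coe.1 ?_⟩
    · rw [hmapT]; nlinarith
    · rw [hmapT]; nlinarith
  · refine absolutelyContinuousOnInterval_congr (((hS.2 i).const_mul (1 - t)).add
      ((LipschitzOnWith.absolutelyContinuousOnInterval
        (LipschitzWith.id.lipschitzOnWith)).const_mul t)) ?_
    rw [uIcc_of_le zero_le_one]
    exact hgext i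
  · rw [show ((T.map i y : unitInterval) : ℝ) = f i y from hgf i y,
      show ((T.map i x : unitInterval) : ℝ) = f i x from hgf i x]
    exact hexp i x y hxy

/-! ### Making a map linear near the left endpoint -/

/-- A smooth function equal to `1` on `(-∞,1]` and to `0` on `[2,∞)`. -/
def cutoff (x : ℝ) : ℝ := Real.smoothTransition (2 - x)

theorem contDiff_cutoff : ContDiff ℝ 1 cutoff :=
  Real.smoothTransition.contDiff.comp (contDiff_const.sub contDiff_id)

theorem cutoff_of_le {x : ℝ} (h : x ≤ 1) : cutoff x = 1 :=
  Real.smoothTransition.one_of_one_le (by linarith)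

theorem cutoff_of_ge {x : ℝ} (h : 2 ≤ x) : cutoff x = 0 :=
  Real.smoothTransition.zero_of_nonpos (by linarith)

theorem cutoff_nonneg (x : ℝ) : 0 ≤ cutoff x := Real.smoothTransition.nonneg _

theorem cutoff_le_one (x : ℝ) : cutoff x ≤ 1 := Real.smoothTransition.le_one _

theorem deriv_cutoff_of_ge {x : ℝ} (h : 2 ≤ x) : deriv cutoff x = 0 :=
  IsLocalMin.deriv_eq_zero (Eventually.of_forall fun y => by
    rw [cutoff_of_ge h]; exact cutoff_nonneg y)

theorem exists_deriv_cutoff_bound : ∃ C, 0 ≤ C ∧ ∀ x ∈ Icc (0 : ℝ) 2, |deriv cutoff x| ≤ C := by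
  obtain ⟨C, hC⟩ := isCompact_Icc.exists_bound_of_continuousOn (s := Icc (0 : ℝ) 2)
    (contDiff_cutoff.continuous_deriv le_rfl).continuousOn
  exact ⟨C, (norm_nonneg _).trans (hC 0 ⟨le_rfl, zero_le_two⟩), hC⟩

/-- The correction that makes `G` linear with slope `s` on `[0,δ]`. -/
def linCorrection (G : ℝ → ℝ) (s δ x : ℝ) : ℝ := cutoff (x / δ) * (s * x - G x)

theorem linCorrection_of_ge {G : ℝ → ℝ} {s δ x : ℝ} (hδ : 0 < δ) (hx : 2 * δ ≤ x) :
    linCorrection G s δ x = 0 := by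
  rw [linCorrection, cutoff_of_ge ((le_div_iff₀ hδ).2 hx), zero_mul]

theorem hasDerivWithinAt_linCorrection {G : ℝ → ℝ} {s δ x d : ℝ} {A : Set ℝ}
    (hG : HasDerivWithinAt G d A x) : HasDerivWithinAt (linCorrection G s δ)
      (deriv cutoff (x / δ) / δ * (s * x - G x) + cutoff (x / δ) * (s - d)) A x := by
  have h1 : HasDerivAt (fun y => cutoff (y / δ)) (deriv cutoff (x / δ) * (1 / δ)) x :=
    HasDerivAt.comp (h₂ := cutoff) (h := fun y => y / δ) x
      ((contDiff_cutoff.differentiable one_ne_zero) (x / δ)).hasDerivAt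
      ((hasDerivAt_id x).div_const δ)
  have h2 : HasDerivWithinAt (fun y => s * y - G y) (s * 1 - d) A x :=
    ((hasDerivWithinAt_id x A).const_mul s).sub hG
  refine (h1.hasDerivWithinAt.mul h2).congr_deriv ?_
  ring

theorem IsCPlus.exists_linCorrection_bound (hβ : 0 < β) {g : unitInterval → unitInterval}
    (hg : IsCPlus β g) {e : ℝ} (he : 0 < e) : ∃ ω > 0, ∃ δ₀ > 0, 2 * δ₀ ≤ β ∧
      ∀ s, |s - endDeriv β g 0| < ω → ∀ δ, 0 < δ → δ ≤ δ₀ → ∀ x ∈ ends β, 0 ≤ x →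
        |deriv cutoff (x / δ) / δ * (s * x - extendReal g x) +
          cutoff (x / δ) * (s - endDeriv β g x)| ≤ e := by
  obtain ⟨C, hC0, hC⟩ := exists_deriv_cutoff_bound
  set ω := e / (4 * C + 2) with hω
  have hω0 : 0 < ω := by positivity
  have hnear : ∀ᶠ x in 𝓝[ends β] 0, |endDeriv β g x - endDeriv β g 0| < ω := by
    have := Metric.tendsto_nhds.1 (hg.continuousOn_endDeriv hβ 0 (zero_mem_ends hβ)) ω hω0
    simpa only [Real.dist_eq] using this
  obtain ⟨δ₁, hδ₁, hδ₁'⟩ :=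
    (nhdsWithin_hasBasis Metric.nhds_basis_closedBall _).eventually_iff.1 hnear
  refine ⟨ω, hω0, min δ₁ β / 2, half_pos (lt_min hδ₁ hβ), by linarith [min_le_right δ₁ β],
    fun s hs δ hδ hδδ x hx hx0 => ?_⟩
  rcases lt_or_ge (2 * δ) x with hlt | hle
  · have h2 : 2 ≤ x / δ := (le_div_iff₀ hδ).2 hlt.le
    rw [cutoff_of_ge h2, deriv_cutoff_of_ge h2]
    simpa using he.le
  have hsub : Icc 0 (2 * δ) ⊆ ends β := fun z hz =>
    Or.inl ⟨hz.1, hz.2.trans (by linarith [min_le_right δ₁ β])⟩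
  have hd : ∀ z ∈ Icc 0 (2 * δ), |s - endDeriv β g z| ≤ 2 * ω := by
    intro z hz
    have h1 : |endDeriv β g z - endDeriv β g 0| < ω := by
      refine hδ₁' ⟨?_, hsub hz⟩
      rw [Metric.mem_closedBall, Real.dist_eq, sub_zero, abs_of_nonneg hz.1]
      exact hz.2.trans (by linarith [min_le_left δ₁ β])
    rw [abs_lt] at h1 hs
    rw [abs_le]
    constructor <;> linarith [h1.1, h1.2, hs.1, hs.2]
  have h3 : |s * x - extendReal g x| ≤ 2 * ω * x := by
    have := (convex_Icc 0 (2 * δ)).norm_image_sub_le_of_norm_hasDerivWithin_le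
      (f := fun z => s * z - extendReal g z) (f' := fun z => s * 1 - endDeriv β g z) (C := 2 * ω)
      (fun z hz => ((hasDerivWithinAt_id z _).const_mul s).sub
        ((hg.hasDerivWithinAt (hsub hz)).mono hsub))
      (fun z hz => by simpa using hd z hz) (x := 0) (y := x) ⟨le_rfl, by linarith⟩ ⟨hx0, hle⟩
    simpa [hg.extendReal_zero, abs_of_nonneg hx0] using this
  have h4 : |deriv cutoff (x / δ)| ≤ C :=
    hC _ ⟨div_nonneg hx0 hδ.le, (div_le_iff₀ hδ).2 hle⟩
  refine (abs_add_le _ _).trans ?_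
  rw [abs_mul, abs_mul, abs_div, abs_of_pos hδ, abs_of_nonneg (cutoff_nonneg _)]
  have h5 : |deriv cutoff (x / δ)| / δ * |s * x - extendReal g x| ≤ C / δ * (2 * ω * (2 * δ)) := by
    gcongr
    exact h3.trans (by gcongr)
  have h6 : cutoff (x / δ) * |s - endDeriv β g x| ≤ 1 * (2 * ω) :=
    mul_le_mul (cutoff_le_one _) (hd x ⟨hx0, hle⟩) (abs_nonneg _) zero_le_one
  have h7 : C / δ * (2 * ω * (2 * δ)) = 4 * C * ω := by field_simp; ring
  have h8 : ω * (4 * C + 2) = e := by rw [hω]; field_simp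
  linarith

theorem exists_linearization (hβ : 0 < β) (hβ' : β < 1 / 2) {g : unitInterval ≃ₜ unitInterval}
    (hg : IsCPlus β g) (hac : AbsolutelyContinuousOnInterval (extendReal g) 0 1) {t : ℝ}
    (ht : 0 < t) (hexp : Expanding t g) {e : ℝ} (he : 0 < e) : ∃ ω > 0, ∃ δ₀ > 0,
      ∀ s, |s - endDeriv β g 0| < ω → ∀ δ, 0 < δ → δ ≤ δ₀ → ∃ f : unitInterval ≃ₜ unitInterval,
        IsCPlus β f ∧ AbsolutelyContinuousOnInterval (extendReal f) 0 1 ∧ Expanding (t / 2) f ∧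
        (∀ x, |(f x : ℝ) - g x| ≤ e) ∧
        (∀ x ∈ ends β, |endDeriv β f x - endDeriv β g x| ≤ e) ∧
        (∀ x : unitInterval, (x : ℝ) ≤ δ → (f x : ℝ) = s * x) ∧
        ∀ x : unitInterval, ∃ θ ∈ Icc (0 : ℝ) 1, (f x : ℝ) = (1 - θ) * g x + θ * (s * x) ∧
          (2 * δ ≤ x → θ = 0) := by
  obtain ⟨ω, hω, δ₀, hδ₀, hδβ, H⟩ := hg.exists_linCorrection_bound hβ (lt_min he (half_pos ht))
  set e' := min e (t / 2)
  have he' : 0 < e' := lt_min he (half_pos ht)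
  refine ⟨ω, hω, δ₀, hδ₀, fun s hs δ hδ hδδ => ?_⟩
  set u := linCorrection (extendReal g) s δ with hu
  have hends : ∀ x ∈ ends β, 0 ≤ x := fun x hx => (ends_subset hβ' hx).1
  have hder : ∀ x ∈ ends β, ∃ d, HasDerivWithinAt u d (ends β) x ∧ |d| ≤ e' := fun x hx =>
    ⟨_, hasDerivWithinAt_linCorrection (hg.hasDerivWithinAt hx), H s hs δ hδ hδδ x hx (hends x hx)⟩
  have hu0 : u 0 = 0 := by simp [hu, linCorrection, hg.extendReal_zero]
  have hlip0 : ∀ x ∈ Icc 0 β, ∀ y ∈ Icc 0 β, |u y - u x| ≤ e' * |y - x| := by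
    have hsub : Icc 0 β ⊆ ends β := subset_union_left
    intro x hx y hy
    choose! d hd using hder
    exact (convex_Icc 0 β).norm_image_sub_le_of_norm_hasDerivWithin_le
      (fun z hz => (hd z (hsub hz)).1.mono hsub) (fun z hz => (hd z (hsub hz)).2) hx hy
  have hlip1 : ∀ x ∈ Icc (0 : ℝ) 1, ∀ y ∈ Icc (0 : ℝ) 1, x ≤ y → |u y - u x| ≤ e' * (y - x) := by
    intro x hx y hy hxy
    rcases le_or_gt y β with hyβ | hyβ
    · have := hlip0 x ⟨hx.1, hxy.trans hyβ⟩ y ⟨hy.1, hyβ⟩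
      rwa [abs_of_nonneg (sub_nonneg.2 hxy)] at this
    rw [hu, linCorrection_of_ge hδ (by linarith : 2 * δ ≤ y), ← hu]
    rcases le_or_gt (2 * δ) x with hxδ | hxδ
    · rw [hu, linCorrection_of_ge hδ hxδ, sub_zero, abs_zero]
      exact mul_nonneg he'.le (sub_nonneg.2 hxy)
    · have := hlip0 x ⟨hx.1, by linarith⟩ (2 * δ) ⟨by linarith, by linarith⟩
      rw [hu, linCorrection_of_ge hδ le_rfl, ← hu, abs_of_pos (sub_pos.2 hxδ)] at this
      exact this.trans (mul_le_mul_of_nonneg_left (by linarith) he'.le)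
  have hlip : LipschitzOnWith (Real.toNNReal e') u (Icc 0 1) := by
    refine LipschitzOnWith.of_dist_le_mul fun x hx y hy => ?_
    rw [Real.coe_toNNReal _ he'.le, Real.dist_eq, Real.dist_eq]
    rcases le_total x y with h | h
    · rw [abs_sub_comm, abs_sub_comm x, abs_of_nonneg (sub_nonneg.2 h)]
      exact hlip1 x hx y hy h
    · rw [abs_of_nonneg (sub_nonneg.2 h)]
      exact hlip1 y hy x hx h
  have hgrow : ∀ x ∈ Icc (0 : ℝ) 1, ∀ y ∈ Icc (0 : ℝ) 1, x ≤ y →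
      t / 2 * (y - x) ≤ extendReal g y + u y - (extendReal g x + u x) := by
    intro x hx y hy hxy
    have h1 := hexp ⟨x, hx⟩ ⟨y, hy⟩ hxy
    rw [← extendReal_of_mem, ← extendReal_of_mem] at h1
    have h2 := (abs_le.1 (hlip1 x hx y hy hxy)).1
    have h3 : e' * (y - x) ≤ t / 2 * (y - x) :=
      mul_le_mul_of_nonneg_right (min_le_right _ _) (sub_nonneg.2 hxy)
    simp only at h1
    linarith
  have hδ1 : 2 * δ ≤ 1 := by linarith
  obtain ⟨f, hf, hfx, hfext⟩ := exists_homeomorph hβ' (f := fun x => extendReal g x + u x)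
    (by simp [hg.extendReal_zero, hu0])
    (by simp [hg.extendReal_one, hu, linCorrection_of_ge hδ hδ1])
    (fun x hx y hy hxy => by
      have h1 := hgrow x hx y hy hxy.le
      have h2 := mul_pos (half_pos ht) (sub_pos.2 hxy)
      dsimp only
      linarith)
    ((continuous_extendReal hg.continuous).continuousOn.add hlip.continuousOn)
    (hg.contDiffOn.add ((contDiff_cutoff.comp (contDiff_id.div_const δ)).contDiffOn.mul
      ((contDiffOn_const.mul contDiffOn_id).sub hg.contDiffOn)))
  have hfx' : ∀ x : unitInterval, (f x : ℝ) = g x + u x := fun x => by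
    rw [hfx, extendReal_coe]
  refine ⟨f, hf, ?_, fun x y hxy => ?_, fun x => ?_, fun x hx => ?_, fun x hx => ?_, fun x => ?_⟩
  · refine absolutelyContinuousOnInterval_congr (hac.add (LipschitzOnWith.absolutelyContinuousOnInterval
      (f := u) (K := Real.toNNReal e') ?_)) ?_
    · rwa [uIcc_of_le zero_le_one]
    · rwa [uIcc_of_le zero_le_one]
  · rw [hfx, hfx]
    exact hgrow x x.2 y y.2 hxy
  · have h1 := hlip1 0 ⟨le_rfl, zero_le_one⟩ x x.2 x.2.1
    rw [hu0, sub_zero, sub_zero] at h1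
    rw [hfx', add_sub_cancel_left]
    refine h1.trans ((mul_le_of_le_one_right he'.le x.2.2).trans (min_le_left _ _))
  · obtain ⟨d, hd, hd'⟩ := hder x hx
    rw [endDeriv_eq hβ (hfext.mono (ends_subset hβ')) hx ((hg.hasDerivWithinAt hx).add hd),
      add_sub_cancel_left]
    exact hd'.trans (min_le_left _ _)
  · rw [hfx', hu, linCorrection, cutoff_of_le ((div_le_one hδ).2 hx), extendReal_coe]
    ring
  · refine ⟨cutoff (x / δ), ⟨cutoff_nonneg _, cutoff_le_one _⟩, ?_, fun h =>
      cutoff_of_ge ((le_div_iff₀ hδ).2 h)⟩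
    rw [hfx', hu, linCorrection, extendReal_coe]
    ring

/-! ### Minimality -/

theorem exists_nat_combination_mem_Ioo {p q u v : ℝ} (hp : p < 0) (hq : 0 < q)
    (hpq : Irrational (p / q)) (huv : u < v) :
    ∃ m n : ℕ, u < m * p + n * q ∧ m * p + n * q < v := by
  have : Fact (0 < q) := ⟨hq⟩
  have hdense : DenseRange fun n : ℕ => n • (p : AddCircle q) :=
    denseRange_zsmul_iff_nsmul.1 (AddCircle.denseRange_zsmul_coe_iff.2 hpq)
  obtain ⟨M, hM⟩ := exists_nat_gt (-u / -p)
  rw [div_lt_iff₀ (neg_pos.2 hp)] at hM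
  have hopen : IsOpen ((QuotientAddGroup.mk : ℝ → AddCircle q) '' Ioo (u - M * p) (v - M * p)) :=
    QuotientAddGroup.isOpenMap_coe _ isOpen_Ioo
  obtain ⟨m, w, hw, hmw⟩ := hdense.exists_mem_open hopen
    ((nonempty_Ioo.2 (by linarith)).image _)
  have hmw' : ((w - m * p : ℝ) : AddCircle q) = 0 := by
    rw [AddCircle.coe_sub, sub_eq_zero, ← nsmul_eq_mul, AddCircle.coe_nsmul]; exact hmw
  obtain ⟨z, hz⟩ := (AddCircle.coe_eq_zero_iff q).1 hmw'
  rw [zsmul_eq_mul] at hz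
  have hmp : (m : ℝ) * p ≤ 0 := mul_nonpos_of_nonneg_of_nonpos m.cast_nonneg hp.le
  have hz0 : 0 < (z : ℝ) * q := by linarith [hw.1]
  have hz1 : 0 < z := by exact_mod_cast pos_of_mul_pos_left hz0 hq.le
  lift z to ℕ using hz1.le
  refine ⟨m + M, z, ?_⟩
  push_cast at hz ⊢
  constructor <;> linarith [hw.1, hw.2]

/-- If two of the maps are linear near `0`, with logarithmically independent slopes, then every
nonempty open set is reached from every point of `(0,1)`. -/
theorem Ioo_subset_of_preimage_subset {T : IFS k β}
    (hm : ∀ x : unitInterval, 0 < x → x < 1 → ∃ i j, T.map i x < x ∧ x < T.map j x)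
    {a b : Fin k} {δ p q : ℝ} (hδ : 0 < δ) (hp0 : 0 < p) (hp1 : p < 1) (hq : 1 < q)
    (hirr : Irrational (Real.log p / Real.log q))
    (ha : ∀ x : unitInterval, (x : ℝ) ≤ δ → (T.map a x : ℝ) = p * x)
    (hb : ∀ x : unitInterval, (x : ℝ) ≤ δ → (T.map b x : ℝ) = q * x)
    {O : Set unitInterval} (hO : IsOpen O) (hne : (O ∩ Ioo 0 1).Nonempty)
    (hinv : ∀ i x, T.map i x ∈ O → x ∈ O) : Ioo 0 1 ⊆ O := by
  have hpos : ∀ i (x : unitInterval), 0 < x → 0 < T.map i x := fun i x hx => by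
    have := T.strictMono i hx
    rwa [(T.isCPlus i).map_zero] at this
  have hlt1 : ∀ i (x : unitInterval), x < 1 → T.map i x < 1 := fun i x hx => by
    have := T.strictMono i hx
    rwa [(T.isCPlus i).map_one] at this
  obtain ⟨y₀, hy₀O, hy₀0, hy₀δ⟩ : ∃ y ∈ O, 0 < y ∧ (y : ℝ) < δ := by
    by_contra! hcon
    have hs0 : (0 : unitInterval) < sInf (O ∩ Ioo 0 1) := by
      obtain ⟨z, hz⟩ := hne
      have hδ1 : δ ≤ 1 := (hcon z hz.1 hz.2.1).trans z.2.2
      have : (⟨δ, hδ.le, hδ1⟩ : unitInterval) ≤ sInf (O ∩ Ioo 0 1) :=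
        le_sInf fun y hy => hcon y hy.1 hy.2.1
      exact lt_of_lt_of_le (Subtype.coe_lt_coe.1 hδ) this
    have hs1 : sInf (O ∩ Ioo 0 1) < (1 : unitInterval) := by
      obtain ⟨z, hz⟩ := hne
      exact (sInf_le hz).trans_lt hz.2.2
    obtain ⟨-, j, -, hj⟩ := hm _ hs0 hs1
    obtain ⟨y, hy, hyj⟩ := sInf_lt_iff.1 hj
    obtain ⟨w, rfl⟩ := (T.map j).surjective y
    have hw0 : 0 < w := by
      rw [← (T.strictMono j).lt_iff_lt, (T.isCPlus j).map_zero]; exact hy.2.1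
    have hw1 : w < 1 := by
      rw [← (T.strictMono j).lt_iff_lt, (T.isCPlus j).map_one]; exact hy.2.2
    exact absurd (sInf_le (show w ∈ O ∩ Ioo 0 1 from ⟨hinv j w hy.1, hw0, hw1⟩))
      (not_le.2 ((T.strictMono j).lt_iff_lt.1 hyj))
  have hy₀0' : (0 : ℝ) < y₀ := hy₀0
  obtain ⟨r, hr, hball⟩ := Metric.isOpen_iff.1 hO y₀ hy₀O
  set u := max ((y₀ : ℝ) / 2) (y₀ - r) with hu
  set v := min δ (y₀ + r) with hv
  have hu0 : 0 < u := lt_max_of_lt_left (half_pos hy₀0')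
  have huv : u < v := by
    have h1 : u < y₀ := max_lt (half_lt_self hy₀0') (by linarith)
    exact h1.trans (lt_min hy₀δ (by linarith))
  have huvO : ∀ x : unitInterval, u < x → (x : ℝ) < v → x ∈ O := fun x hxu hxv => by
    refine hball ?_
    rw [Metric.mem_ball, Subtype.dist_eq, Real.dist_eq, abs_lt]
    constructor
    · linarith [(le_max_right _ _).trans_lt hxu]
    · linarith [hxv.trans_le (min_le_right _ _)]
  have hstepb : ∀ (n : ℕ) (x : unitInterval), u < q ^ n * x → q ^ n * x < v → x ∈ O := by
    intro n
    induction n with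
    | zero => intro x h1 h2; exact huvO x (by simpa using h1) (by simpa using h2)
    | succ n ih =>
      intro x h1 h2
      have hx : (T.map b x : ℝ) = q * x := by
        refine hb x (le_trans ?_ (h2.le.trans (min_le_left _ _)))
        exact le_mul_of_one_le_left x.2.1 (one_le_pow₀ hq.le)
      refine hinv b x (ih _ ?_ ?_) <;> rw [hx, ← mul_assoc, ← pow_succ] <;> assumption
  have hstepa : ∀ (n m : ℕ) (x : unitInterval), (x : ℝ) ≤ δ → u < q ^ n * (p ^ m * x) →
      q ^ n * (p ^ m * x) < v → x ∈ O := by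
    intro n m
    induction m with
    | zero => intro x _ h1 h2; exact hstepb n x (by simpa using h1) (by simpa using h2)
    | succ m ih =>
      intro x hxδ h1 h2
      have hx := ha x hxδ
      have hle : (T.map a x : ℝ) ≤ δ := by
        rw [hx]; exact (mul_le_of_le_one_left x.2.1 hp1.le).trans hxδ
      refine hinv a x (ih _ hle ?_ ?_) <;> rw [hx, ← mul_assoc (p ^ m), ← pow_succ] <;> assumption
  have hsmall : ∀ x : unitInterval, 0 < x → (x : ℝ) < δ → x ∈ O := by
    intro x hx0 hxδ
    have hx0' : (0 : ℝ) < x := hx0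
    obtain ⟨m, n, h1, h2⟩ := exists_nat_combination_mem_Ioo (Real.log_neg hp0 hp1)
      (Real.log_pos hq) hirr (sub_lt_sub_right (Real.log_lt_log hu0 huv) (Real.log x))
    have hlog : Real.log (q ^ n * (p ^ m * x)) =
        m * Real.log p + n * Real.log q + Real.log x := by
      rw [Real.log_mul (by positivity) (by positivity), Real.log_mul (by positivity) hx0'.ne',
        Real.log_pow, Real.log_pow]
      ring
    have hqpos : 0 < q ^ n * (p ^ m * x) := by positivity
    refine hstepa n m x hxδ.le ?_ ?_
    · rw [← Real.log_lt_log_iff hu0 hqpos, hlog]; linarith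
    · rw [← Real.log_lt_log_iff hqpos (hu0.trans huv), hlog]; linarith
  intro x hx
  by_contra hxO
  set C := Ioo (0 : unitInterval) 1 \ O
  have hs0 : (0 : unitInterval) < sInf C := by
    have hδ1 : δ ≤ 1 := by
      by_contra hδ1
      exact hxO (hsmall x hx.1 (x.2.2.trans_lt (not_le.1 hδ1)))
    have : (⟨δ, hδ.le, hδ1⟩ : unitInterval) ≤ sInf C := le_sInf fun y hy => by
      by_contra hlt
      exact hy.2 (hsmall y hy.1.1 (not_le.1 hlt))
    exact lt_of_lt_of_le (Subtype.coe_lt_coe.1 hδ) this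
  have hs1 : sInf C < 1 := (sInf_le (show x ∈ C from ⟨hx, hxO⟩)).trans_lt hx.2
  obtain ⟨i, -, hi, -⟩ := hm _ hs0 hs1
  have hi' : sInf C < (T.map i).symm (sInf C) := by
    rw [← (T.strictMono i).lt_iff_lt, Homeomorph.apply_symm_apply]; exact hi
  obtain ⟨y, hy, hyi⟩ := sInf_lt_iff.1 hi'
  have hyC : T.map i y ∈ C :=
    ⟨⟨hpos i y hy.1.1, hlt1 i y hy.1.2⟩, fun h => hy.2 (hinv i y h)⟩
  refine absurd (sInf_le hyC) (not_le.2 ?_)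
  rw [← (T.strictMono i).lt_iff_lt, Homeomorph.apply_symm_apply] at hyi
  exact hyi

theorem exists_slope {d q ω : ℝ} (hd : 0 < d) (hω : 0 < ω)
    (h0 : Real.log q ≠ 0) :
    ∃ s, 0 < s ∧ s < d ∧ |s - d| < ω ∧ Irrational (Real.log s / Real.log q) := by
  have hc : (range fun r : ℚ => Real.exp (r * Real.log q)).Countable := countable_range _
  obtain ⟨s, hs, hs1, hs2⟩ := (hc.dense_compl ℝ).exists_between
    (max_lt hd (sub_lt_self d hω) : max 0 (d - ω) < d)
  have hs0 : 0 < s := (le_max_left _ _).trans_lt hs1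
  refine ⟨s, hs0, hs2, ?_, ?_⟩
  · rw [abs_lt]
    constructor <;> linarith [(le_max_right _ _).trans_lt hs1]
  · rintro ⟨r, hr⟩
    refine hs ⟨r, ?_⟩
    simp only [hr, div_mul_cancel₀ _ h0, Real.exp_log hs0]

/-- Every nonempty open set is reached from every point of `(0,1)`. -/
def IsMinimal (T : IFS k β) : Prop :=
  ∀ O : Set unitInterval, IsOpen O → (O ∩ Ioo 0 1).Nonempty → (∀ i x, T.map i x ∈ O → x ∈ O) →
    Ioo 0 1 ⊆ O

theorem IsAdmissible.exists_endDeriv_le_one (hβ : 0 < β) (hβ' : β < 1 / 2) {S : IFS k β}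
    (h : IsAdmissible S) : ∃ a, endDeriv β (S.map a) 0 ≤ 1 := by
  by_contra! hcon
  have hev : ∀ᶠ x in 𝓝[ends β] 0, ∀ i, 1 < endDeriv β (S.map i) x :=
    eventually_all.2 fun i => ((S.isCPlus i).continuousOn_endDeriv hβ 0 (zero_mem_ends hβ)).eventually
      (lt_mem_nhds (hcon i))
  obtain ⟨δ, hδ, hδ'⟩ :=
    (nhdsWithin_hasBasis Metric.nhds_basis_closedBall _).eventually_iff.1 hev
  have hm : 0 < min δ β := lt_min hδ hβ
  have hm1 : min δ β < 1 := (min_le_right _ _).trans_lt (by linarith)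
  obtain ⟨i, -, hi, -⟩ := h.moves ⟨min δ β, hm.le, hm1.le⟩ (Subtype.coe_lt_coe.1 hm)
    (Subtype.coe_lt_coe.1 hm1)
  have hsub : Icc 0 (min δ β) ⊆ ends β := fun z hz =>
    Or.inl ⟨hz.1, hz.2.trans (min_le_right _ _)⟩
  have h1 := (S.isCPlus i).mul_sub_le hsub (m := 1) (fun z hz => (hδ' ⟨by
    rw [Metric.mem_closedBall, Real.dist_eq, sub_zero, abs_of_pos hz.1]
    exact hz.2.le.trans (min_le_left _ _), hsub (Ioo_subset_Icc_self hz)⟩ i).le)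
    (x := 0) (y := min δ β) ⟨le_rfl, hm.le⟩ ⟨hm.le, le_rfl⟩ hm.le
  rw [(S.isCPlus i).extendReal_zero, extendReal_of_mem _ ⟨hm.le, hm1.le⟩] at h1
  have hi : (S.map i ⟨min δ β, hm.le, hm1.le⟩ : ℝ) < min δ β := hi
  linarith

theorem IsAdmissible.exists_one_lt_endDeriv {S : IFS k β} (h : IsAdmissible S) :
    ∃ b, 1 < endDeriv β (S.map b) 0 := by
  by_contra! hcon
  refine absurd h.lyapunov_zero_pos (not_lt.2 (Finset.sum_nonpos fun i _ => ?_))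
  exact mul_nonpos_of_nonneg_of_nonpos (S.prob_nonneg i)
    (Real.log_nonpos (h.deriv_zero_pos i).le (hcon i))

theorem IsCPlus.exists_forall_lt (hβ : 0 < β) {g : unitInterval → unitInterval}
    (hg : IsCPlus β g) (h : 1 < endDeriv β g 0) :
    ∃ δ > 0, ∀ x : unitInterval, 0 < x → (x : ℝ) ≤ δ → x < g x := by
  obtain ⟨m, hm1, hm⟩ := exists_between h
  have hev := (hg.continuousOn_endDeriv hβ 0 (zero_mem_ends hβ)).eventually (lt_mem_nhds hm)
  obtain ⟨δ, hδ, hδ'⟩ :=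
    (nhdsWithin_hasBasis Metric.nhds_basis_closedBall _).eventually_iff.1 hev
  have hmin : 0 < min δ β := lt_min hδ hβ
  refine ⟨min δ β, hmin, fun x hx0 hx => ?_⟩
  have hsub : Icc 0 (min δ β) ⊆ ends β := fun z hz =>
    Or.inl ⟨hz.1, hz.2.trans (min_le_right _ _)⟩
  have h1 := hg.mul_sub_le hsub (m := m) (fun z hz => (hδ' ⟨by
    rw [Metric.mem_closedBall, Real.dist_eq, sub_zero, abs_of_pos hz.1]
    exact hz.2.le.trans (min_le_left _ _), hsub (Ioo_subset_Icc_self hz)⟩).le)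
    (x := 0) (y := x) ⟨le_rfl, hmin.le⟩ ⟨x.2.1, hx⟩ x.2.1
  rw [hg.extendReal_zero, extendReal_coe] at h1
  have hx0 : (0 : ℝ) < x := hx0
  refine Subtype.coe_lt_coe.1 ?_
  nlinarith

/-- Minimal systems with expanding maps are dense among the absolutely continuous systems. -/
theorem exists_isMinimal (hβ : 0 < β) (hβ' : β < 1 / 2) {S : IFS k β}
    (hS : S ∈ admissibleAC k β) {t : ℝ} (ht : 0 < t) (hexp : ∀ i, Expanding t (S.map i)) {ε : ℝ}
    (hε : 0 < ε) : ∃ T ∈ admissibleAC k β, dist T S < ε ∧ (∀ i, Expanding (t / 2) (T.map i)) ∧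
      IsMinimal T := by
  obtain ⟨ε', hε', hadm⟩ := hS.1.exists_dist_lt hβ
  obtain ⟨e, he, hdist⟩ := S.exists_dist_lt (lt_min hε hε')
  obtain ⟨a, ha⟩ := hS.1.exists_endDeriv_le_one hβ hβ'
  obtain ⟨b, hb⟩ := hS.1.exists_one_lt_endDeriv
  have hab : a ≠ b := by rintro rfl; linarith
  obtain ⟨δb, hδb, hδb'⟩ := (S.isCPlus b).exists_forall_lt hβ hb
  obtain ⟨ωa, hωa, δa, hδa, Ha⟩ := exists_linearization hβ hβ' (S.isCPlus a) (hS.2 a) ht (hexp a) he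
  obtain ⟨ωb, hωb, δc, hδc, Hb⟩ := exists_linearization hβ hβ' (S.isCPlus b) (hS.2 b) ht (hexp b) he
  obtain ⟨p, hp0, hpd, hpω, hirr⟩ := exists_slope (q := endDeriv β (S.map b) 0)
    (hS.1.deriv_zero_pos a) hωa (Real.log_pos hb).ne'
  set q := endDeriv β (S.map b) 0 with hq
  obtain ⟨δ, hδ, hδmin⟩ := exists_between (lt_min (half_pos hδb) (lt_min hδa hδc))
  rw [lt_min_iff, lt_min_iff] at hδmin
  obtain ⟨fa, hfa, hfaac, hfaexp, hfae, hfad, hfalin, hfaconv⟩ := Ha p hpω δ hδ hδmin.2.1.le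
  obtain ⟨fb, hfb, hfbac, hfbexp, hfbe, hfbd, hfblin, hfbconv⟩ :=
    Hb q (by simpa using hωb) δ hδ hδmin.2.2.le
  have hex : ∀ i, ∃ f : unitInterval ≃ₜ unitInterval, IsCPlus β f ∧
      AbsolutelyContinuousOnInterval (extendReal f) 0 1 ∧ Expanding (t / 2) f ∧
      (∀ x, |(f x : ℝ) - S.map i x| ≤ e) ∧
      (∀ x ∈ ends β, |endDeriv β f x - endDeriv β (S.map i) x| ≤ e) ∧
      (∀ x : unitInterval, 0 < x → S.map i x < x → f x < x) ∧
      (∀ x : unitInterval, 2 * δ ≤ x → x < S.map i x → x < f x) ∧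
      (i = a → ∀ x : unitInterval, (x : ℝ) ≤ δ → (f x : ℝ) = p * x) ∧
      (i = b → ∀ x : unitInterval, (x : ℝ) ≤ δ → (f x : ℝ) = q * x) ∧
      (i = b → ∀ x : unitInterval, 0 < x → (x : ℝ) < 2 * δ → x < f x) := by
    intro i
    by_cases hia : i = a
    · subst hia
      refine ⟨fa, hfa, hfaac, hfaexp, hfae, hfad, fun x hx0 hx => ?_, fun x hxδ hx => ?_,
        fun _ => hfalin, fun h => absurd h hab, fun h => absurd h hab⟩
      · obtain ⟨θ, hθ, hfx, -⟩ := hfaconv x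
        have hx0 : (0 : ℝ) < x := hx0
        have hx : (S.map i x : ℝ) < x := hx
        refine Subtype.coe_lt_coe.1 ?_
        have h1 : p * x < x := mul_lt_of_lt_one_left hx0 (hpd.trans_le ha)
        rw [hfx]
        rcases hθ.1.eq_or_lt with h0 | h0
        · rw [← h0]; linarith
        · nlinarith [mul_nonneg (sub_nonneg.2 hθ.2) (sub_nonneg.2 hx.le),
            mul_pos h0 (sub_pos.2 h1)]
      · obtain ⟨θ, -, hfx, hθ⟩ := hfaconv x
        rw [hθ hxδ] at hfx
        refine Subtype.coe_lt_coe.1 ?_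
        rw [hfx]
        simpa using hx
    by_cases hib : i = b
    · subst hib
      refine ⟨fb, hfb, hfbac, hfbexp, hfbe, hfbd, fun x hx0 hx => ?_, fun x hxδ hx => ?_,
        fun h => absurd h hia, fun _ => hfblin, fun _ x hx0 hxδ => ?_⟩
      · have hxδ : 2 * δ ≤ x := by
          by_contra hlt
          exact absurd (hδb' x hx0 (by linarith [hδmin.1])) (not_lt.2 hx.le)
        obtain ⟨θ, -, hfx, hθ⟩ := hfbconv x
        rw [hθ hxδ] at hfx
        refine Subtype.coe_lt_coe.1 ?_
        rw [hfx]
        simpa using hx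
      · obtain ⟨θ, -, hfx, hθ⟩ := hfbconv x
        rw [hθ hxδ] at hfx
        refine Subtype.coe_lt_coe.1 ?_
        rw [hfx]
        simpa using hx
      · obtain ⟨θ, hθ, hfx, -⟩ := hfbconv x
        have hx : (x : ℝ) < S.map i x := hδb' x hx0 (by linarith [hδmin.1])
        have hx0 : (0 : ℝ) < x := hx0
        refine Subtype.coe_lt_coe.1 ?_
        have h1 : x < q * x := lt_mul_of_one_lt_left hx0 hb
        rw [hfx]
        rcases hθ.1.eq_or_lt with h0 | h0
        · rw [← h0]; linarith
        · nlinarith [mul_nonneg (sub_nonneg.2 hθ.2) (sub_nonneg.2 hx.le),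
            mul_pos h0 (sub_pos.2 h1)]
    · refine ⟨S.map i, S.isCPlus i, hS.2 i, fun x y hxy => le_trans ?_ (hexp i x y hxy),
        fun x => by simpa using he.le, fun x _ => by simpa using he.le, fun x _ h => h,
        fun x _ h => h, fun h => absurd h hia, fun h => absurd h hib, fun h => absurd h hib⟩
      exact mul_le_mul_of_nonneg_right (by linarith) (sub_nonneg.2 hxy)
  choose f hf hfac hfexp hfe hfd hleft hright hlina hlinb hrightb using hex
  set T : IFS k β := ⟨f, S.prob, hf, S.prob_nonneg, S.prob_sum⟩
  have hTS : dist T S < min ε ε' := hdist T rfl hfe hfd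
  have hmoves : ∀ x : unitInterval, 0 < x → x < 1 → ∃ i j, T.map i x < x ∧ x < T.map j x := by
    intro x hx0 hx1
    obtain ⟨i, j, hi, hj⟩ := hS.1.moves x hx0 hx1
    rcases lt_or_ge (x : ℝ) (2 * δ) with h | h
    · exact ⟨i, b, hleft i x hx0 hi, hrightb b rfl x hx0 h⟩
    · exact ⟨i, j, hleft i x hx0 hi, hright j x h hj⟩
  refine ⟨T, ⟨hadm T rfl (hTS.trans_le (min_le_right _ _)) hmoves, hfac⟩,
    hTS.trans_le (min_le_left _ _), hfexp, fun O hO hne hinv => ?_⟩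
  exact Ioo_subset_of_preimage_subset hmoves hδ hp0 (hpd.trans_le ha) hb hirr (hlina a rfl)
    (hlinb b rfl) hO hne hinv

/-! ### A homeomorphism that collapses most of an interval to a null set -/

/-- The density that is `0` on `(c,d]` outside `Q`, equal to `κ` on `(c,d] ∩ Q`, and `1` outside
`(c,d]`. -/
def collapseDensity (Q : Set ℝ) (c d κ : ℝ) : ℝ → ℝ :=
  (Ioc c d)ᶜ.indicator (fun _ => 1) + (Q ∩ Ioc c d).indicator fun _ => κ

theorem collapseDensity_of_notMem {Q : Set ℝ} {c d κ z : ℝ} (hz : z ∉ Ioc c d) :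
    collapseDensity Q c d κ z = 1 := by
  simp [collapseDensity, hz]

theorem collapseDensity_of_mem {Q : Set ℝ} {c d κ z : ℝ} (hz : z ∈ Ioc c d) :
    collapseDensity Q c d κ z = Q.indicator (fun _ => κ) z := by
  by_cases hQ : z ∈ Q <;> simp [collapseDensity, hz, hQ]

theorem collapseDensity_nonneg {Q : Set ℝ} {c d κ : ℝ} (hκ : 0 ≤ κ) (z : ℝ) :
    0 ≤ collapseDensity Q c d κ z := by
  rw [collapseDensity, Pi.add_apply]
  exact add_nonneg (indicator_nonneg (fun _ _ => zero_le_one) _) (indicator_nonneg (fun _ _ => hκ) _)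

theorem intervalIntegrable_collapseDensity {Q : Set ℝ} (hQ : MeasurableSet Q) (c d κ x y : ℝ) :
    IntervalIntegrable (collapseDensity Q c d κ) volume x y := by
  have h1 : ∀ (E : Set ℝ) (r : ℝ), MeasurableSet E →
      IntervalIntegrable (E.indicator fun _ => r) volume x y := fun E r hE => by
    rw [intervalIntegrable_iff]
    exact IntegrableOn.indicator (by simp) hE
  exact (h1 _ _ measurableSet_Ioc.compl).add (h1 _ _ (hQ.inter measurableSet_Ioc))

theorem exists_collapse (hβ : 0 < β) (hβ' : β < 1 / 2) {c d : ℝ} (hc : β ≤ c) (hcd : c < d)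
    (hd : d ≤ 1 - β) {η : ENNReal} (hη : η ≠ 0) :
    ∃ ψ : unitInterval ≃ₜ unitInterval, IsCPlus β ψ ∧
      AbsolutelyContinuousOnInterval (extendReal ψ) 0 1 ∧
      (∀ x : unitInterval, (x : ℝ) ∉ Ioo c d → ψ x = x) ∧
      ∃ A : Set unitInterval, MeasurableSet A ∧ volume (ψ '' A) = 0 ∧
        volume ({x : unitInterval | (x : ℝ) ∈ Ioo c d} \ A) ≤ η := by
  obtain ⟨Q, hQr, hQ, hQη⟩ := (range ((↑) : ℚ → ℝ)).exists_isOpen_lt_of_lt (μ := volume) η (by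
    rw [(countable_range _).measure_zero]; exact pos_iff_ne_zero.2 hη)
  have hdense : Dense Q := Rat.denseRange_cast.mono hQr
  have hQpos : ∀ x y, x < y → 0 < volume (Q ∩ Ioo x y) := fun x y hxy =>
    (hQ.inter isOpen_Ioo).measure_pos _ (by
      rw [inter_comm]; exact hdense.inter_open_nonempty _ isOpen_Ioo (nonempty_Ioo.2 hxy))
  set v := volume.real (Q ∩ Ioc c d)
  have hv : 0 < v := ENNReal.toReal_pos
    ((hQpos c d hcd).trans_le (measure_mono (by gcongr; exact Ioo_subset_Ioc_self))).ne'
    ((measure_mono inter_subset_right).trans_lt measure_Ioc_lt_top).ne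
  set κ := (d - c) / v
  have hκ : 0 < κ := div_pos (sub_pos.2 hcd) hv
  set h := collapseDensity Q c d κ with hh
  have hint : ∀ x y, IntervalIntegrable h volume x y := fun x y =>
    intervalIntegrable_collapseDensity hQ.measurableSet c d κ x y
  set f : ℝ → ℝ := fun x => ∫ z in 0..x, h z with hf
  have hf_sub : ∀ x y, f y - f x = ∫ z in x..y, h z := fun x y =>
    intervalIntegral.integral_interval_sub_left (hint _ _) (hint _ _)
  have hone : ∀ x y, x ≤ y → (∀ z ∈ Ioc x y, z ∉ Ioc c d) → f y - f x = y - x := by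
    intro x y hxy hz
    rw [hf_sub, intervalIntegral.integral_of_le hxy,
      setIntegral_congr_fun measurableSet_Ioc (g := fun _ => 1) fun z hz' =>
        collapseDensity_of_notMem (hz z hz')]
    simp [hxy]
  have hf0 : f 0 = 0 := intervalIntegral.integral_same
  have hfc : ∀ x, 0 ≤ x → x ≤ c → f x = x := by
    intro x hx0 hxc
    have := hone 0 x hx0 fun z hz hz' => absurd (hz.2.trans hxc) (not_le.2 hz'.1)
    rwa [hf0, sub_zero, sub_zero] at this
  have hfcd : f d - f c = d - c := by
    rw [hf_sub, intervalIntegral.integral_of_le hcd.le,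
      setIntegral_congr_fun measurableSet_Ioc fun z hz => collapseDensity_of_mem hz,
      setIntegral_indicator hQ.measurableSet, setIntegral_const, inter_comm, smul_eq_mul]
    exact mul_div_cancel₀ _ hv.ne'
  have hfd : ∀ x, d ≤ x → f x = x := by
    intro x hx
    have h1 := hone d x hx fun z hz hz' => absurd hz'.2 (not_le.2 hz.1)
    have h2 := hfc c (hβ.le.trans hc) le_rfl
    linarith
  have hmono : StrictMono f := by
    intro x y hxy
    rw [← sub_pos, hf_sub, intervalIntegral.integral_pos_iff_support_of_nonneg_ae
      (Eventually.of_forall (collapseDensity_nonneg hκ.le)) (hint _ _)]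
    refine ⟨hxy, (hQpos x y hxy).trans_le (measure_mono ?_)⟩
    rintro z ⟨hzQ, hz⟩
    refine ⟨?_, Ioo_subset_Ioc_self hz⟩
    by_cases hzcd : z ∈ Ioc c d
    · rw [Function.mem_support, collapseDensity_of_mem hzcd, indicator_of_mem hzQ]
      exact hκ.ne'
    · rw [Function.mem_support, collapseDensity_of_notMem hzcd]
      exact one_ne_zero
  have hac : AbsolutelyContinuousOnInterval f 0 1 :=
    (hint 0 1).absolutelyContinuousOnInterval_intervalIntegral left_mem_uIcc
  have hid : ∀ x : ℝ, 0 ≤ x → x ∉ Ioo c d → f x = x := by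
    intro x hx0 hx
    rcases le_or_gt x c with hxc | hxc
    · exact hfc x hx0 hxc
    · exact hfd x (not_lt.1 fun hlt => hx ⟨hxc, hlt⟩)
  have hends : EqOn f id (ends β) := by
    rintro x (hx | hx)
    · exact hfc x hx.1 (hx.2.trans hc)
    · exact hfd x (hd.trans hx.1)
  obtain ⟨ψ, hψ, hψf, hψext⟩ := exists_homeomorph hβ' hf0 (hfd 1 (by linarith))
    (hmono.strictMonoOn _) (by
      have := hac.continuousOn
      rwa [uIcc_of_le zero_le_one] at this) (contDiffOn_id.congr hends)
  have hψac : AbsolutelyContinuousOnInterval (extendReal ψ) 0 1 :=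
    absolutelyContinuousOnInterval_congr hac (by rwa [uIcc_of_le zero_le_one])
  refine ⟨ψ, hψ, hψac, fun x hx => Subtype.ext ((hψf x).trans (hid x x.2.1 hx)),
    {x : unitInterval | (x : ℝ) ∈ Ioo c d \ Q}, ?_, ?_, ?_⟩
  · exact measurable_subtype_coe (measurableSet_Ioo.diff hQ.measurableSet)
  · have hA : MeasurableSet {x : unitInterval | (x : ℝ) ∈ Ioo c d \ Q} :=
      measurable_subtype_coe (measurableSet_Ioo.diff hQ.measurableSet)
    have h1 : volume (ψ '' {x : unitInterval | (x : ℝ) ∈ Ioo c d \ Q}) =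
        (volume : Measure unitInterval).map ψ.symm {x : unitInterval | (x : ℝ) ∈ Ioo c d \ Q} := by
      rw [Measure.map_apply ψ.symm.continuous.measurable hA, Homeomorph.image_eq_preimage_symm]
    rw [h1, volume_map_symm_eq_withDensity hψ hψac, withDensity_apply _ hA]
    have h2 : ∀ᵐ x : ℝ, x ∈ Ioo c d → HasDerivAt f (h x) x := by
      filter_upwards [(hint 0 1).ae_hasDerivAt_integral] with x hx hxcd
      refine hx ?_ 0 left_mem_uIcc
      rw [uIcc_of_le zero_le_one]
      exact ⟨by linarith [hxcd.1], by linarith [hxcd.2]⟩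
    have h3 : ∀ᵐ x : unitInterval, (x : ℝ) ∈ Ioo c d → HasDerivAt f (h x) x :=
      unitInterval.measurePreserving_coe.quasiMeasurePreserving.ae (ae_restrict_of_ae h2)
    refine (setLIntegral_congr_fun_ae (g := fun _ => 0) hA ?_).trans (lintegral_zero)
    filter_upwards [h3] with x hx hxA
    have hev : extendReal ψ =ᶠ[𝓝 (x : ℝ)] f := by
      filter_upwards [isOpen_Ioo.mem_nhds hxA.1] with y hy
      exact hψext ⟨by linarith [hy.1], by linarith [hy.2]⟩
    rw [hev.deriv_eq, (hx hxA.1).deriv, hh, collapseDensity_of_mem (Ioo_subset_Ioc_self hxA.1),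
      indicator_of_notMem hxA.2, ENNReal.ofReal_zero]
  · rw [unitInterval.volume_apply]
    refine (measure_mono ?_).trans hQη.le
    rintro _ ⟨x, ⟨hx, hxA⟩, rfl⟩
    by_contra hxQ
    exact hxA ⟨hx, hxQ⟩

/-! ### Density of systems with concentrated stationary distributions -/

theorem extendReal_comp (g h : unitInterval → unitInterval) :
    extendReal (g ∘ h) = extendReal g ∘ extendReal h := by
  funext x
  simp only [extendReal, Function.comp_apply, projIcc_val]

theorem IsCPlus.congr_of_eqOn_ends {f g : unitInterval → unitInterval} (hg : IsCPlus β g)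
    (hf : Continuous f) (hmono : Monotone f) (hβ : 0 < β)
    (h : EqOn (extendReal f) (extendReal g) (ends β)) : IsCPlus β f := by
  refine ⟨hf, hmono, Subtype.ext ?_, Subtype.ext ?_, hg.contDiffOn.congr h⟩
  · have h0 := h (zero_mem_ends hβ)
    rwa [hg.extendReal_zero, show (0 : ℝ) = ((0 : unitInterval) : ℝ) from rfl, extendReal_coe] at h0
  · have h1 := h (one_mem_ends hβ)
    rwa [hg.extendReal_one, show (1 : ℝ) = ((1 : unitInterval) : ℝ) from rfl, extendReal_coe] at h1

theorem mapsTo_of_eqOn_compl {α : Type*} {ψ : α → α} (hψ : Function.Injective ψ) {J : Set α}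
    (h : ∀ x ∉ J, ψ x = x) : MapsTo ψ J J := by
  intro x hx
  by_contra hn
  rw [hψ (h _ hn)] at hn
  exact hn hx

theorem isOpen_reachSet (S : IFS k β) {J : Set unitInterval} (hJ : IsOpen J) (n : ℕ) :
    IsOpen (reachSet S J n) := by
  induction n with
  | zero => exact hJ
  | succ n ih => exact ih.union (isOpen_iUnion fun i => ih.preimage (S.map i).continuous)

/-- For a minimal system, almost every point reaches a given open set. -/
theorem IsMinimal.exists_volume_compl_reachSet_lt {S : IFS k β} (hS : IsMinimal S)
    {J : Set unitInterval} (hJ : IsOpen J) (hne : (J ∩ Ioo 0 1).Nonempty) {c : ENNReal}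
    (hc : c ≠ 0) : ∃ n, volume (reachSet S J n)ᶜ < c := by
  have hmono : Monotone (reachSet S J) := monotone_nat_of_le_succ fun n => subset_union_left
  have hcover : Ioo 0 1 ⊆ ⋃ n, reachSet S J n := by
    refine hS _ (isOpen_iUnion fun n => isOpen_reachSet S hJ n)
      (hne.mono (inter_subset_inter_left _ (subset_iUnion (reachSet S J) 0))) fun i x hx => ?_
    obtain ⟨n, hn⟩ := mem_iUnion.1 hx
    exact mem_iUnion.2 ⟨n + 1, Or.inr (mem_iUnion.2 ⟨i, hn⟩)⟩
  have hnull : volume (⋂ n, (reachSet S J n)ᶜ) = 0 := by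
    rw [← compl_iUnion]
    refine measure_mono_null (compl_subset_compl.2 hcover)
      (measure_mono_null (t := {0, 1}) (fun x hx => ?_) ((Set.toFinite _).measure_zero _))
    by_contra h
    simp only [mem_insert_iff, mem_singleton_iff, not_or] at h
    exact hx ⟨unitInterval.pos_iff_ne_zero.2 h.1, unitInterval.lt_one_iff_ne_one.2 h.2⟩
  have htend := tendsto_measure_iInter_atTop (μ := volume) (s := fun n => (reachSet S J n)ᶜ)
    (fun n => (isOpen_reachSet S hJ n).measurableSet.compl.nullMeasurableSet)
    (fun m n h => compl_subset_compl.2 (hmono h)) ⟨0, measure_ne_top _ _⟩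
  rw [hnull] at htend
  exact (htend.eventually (gt_mem_nhds (pos_iff_ne_zero.2 hc))).exists

/-- Replace the `i`-th map of a system by its composition with `ψ`. -/
def IFS.precomp (S : IFS k β) (i : Fin k) (ψ : unitInterval ≃ₜ unitInterval)
    (h : IsCPlus β (ψ.trans (S.map i))) : IFS k β where
  map := Function.update S.map i (ψ.trans (S.map i))
  prob := S.prob
  isCPlus j := by
    rcases eq_or_ne j i with rfl | hj
    · rwa [Function.update_self]
    · rw [Function.update_of_ne hj]
      exact S.isCPlus j
  prob_nonneg := S.prob_nonneg
  prob_sum := S.prob_sum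

/-- Near any minimal system with expanding maps there are systems whose stationary distributions
are almost carried by a set of small Lebesgue measure. -/
theorem exists_hasConcentratedStationary (hβ : 0 < β) (hβ' : β < 1 / 2) {S : IFS k β}
    (hS : S ∈ admissibleAC k β) {t : ℝ} (ht : 0 < t) (hexp : ∀ i, Expanding t (S.map i))
    (hmin : IsMinimal S) {ε : ℝ} (hε : 0 < ε) {c : ENNReal} (hc : c ≠ 0) :
    ∃ T ∈ admissibleAC k β, dist T S < ε ∧ HasConcentratedStationary T c := by
  obtain ⟨ε', hε', hadm⟩ := hS.1.exists_dist_lt hβ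
  obtain ⟨e, he, hdist⟩ := S.exists_dist_lt (lt_min hε hε')
  set z : unitInterval := ⟨1 / 2, by norm_num, by norm_num⟩ with hz
  have hz0 : 0 < z := Subtype.coe_lt_coe.1 (by norm_num [hz])
  have hz1 : z < 1 := Subtype.coe_lt_coe.1 (by norm_num [hz])
  obtain ⟨i, j, hi, hj⟩ := hS.1.moves z hz0 hz1
  obtain ⟨m, hm, hmz⟩ := exists_between hi
  obtain ⟨m', hmz', hm'⟩ := exists_between hj
  have hnear : ∀ᶠ x in 𝓝 z, S.map i x < m ∧ m < x ∧ x < m' ∧ m' < S.map j x ∧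
      dist (S.map i x) (S.map i z) < e / 2 :=
    ((S.map i).continuous.continuousAt.eventually (gt_mem_nhds hm)).and
      ((lt_mem_nhds hmz).and ((gt_mem_nhds hmz').and
        (((S.map j).continuous.continuousAt.eventually (lt_mem_nhds hm')).and
          ((S.map i).continuous.continuousAt.eventually
            (Metric.ball_mem_nhds _ (half_pos he))))))
  obtain ⟨r₀, hr₀, hball⟩ := Metric.eventually_nhds_iff.1 hnear
  obtain ⟨r, hr, hrlt⟩ := exists_between (lt_min hr₀ (sub_pos.2 hβ'))
  rw [lt_min_iff] at hrlt
  set J : Set unitInterval := {x | (x : ℝ) ∈ Ioo (1 / 2 - r) (1 / 2 + r)} with hJ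
  have hJz : ∀ x ∈ J, dist x z < r₀ := by
    intro x hx
    rw [Subtype.dist_eq, Real.dist_eq, abs_lt]
    have h1 := hx.1
    have h2 := hx.2
    constructor <;> simp only [hz] <;> linarith [hrlt.1]
  have hJopen : IsOpen J := isOpen_Ioo.preimage continuous_subtype_val
  have hzJ : z ∈ J := by
    refine ⟨?_, ?_⟩ <;> simp only [hz] <;> linarith
  have hc2 : c / 2 ≠ 0 := by simpa using hc
  obtain ⟨n, hn⟩ := hmin.exists_volume_compl_reachSet_lt hJopen ⟨z, hzJ, hz0, hz1⟩ hc2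
  set K : NNReal := Real.toNNReal t⁻¹ with hK
  have hKfin : (1 + (k : ENNReal) * K) ^ n ≠ ⊤ :=
    ENNReal.pow_ne_top (ENNReal.add_ne_top.2
      ⟨ENNReal.one_ne_top, ENNReal.mul_ne_top (ENNReal.natCast_ne_top k) ENNReal.coe_ne_top⟩)
  obtain ⟨ψ, hψ, hψac, hψid, A, hA, hψA, hJA⟩ := exists_collapse hβ hβ'
    (c := 1 / 2 - r) (d := 1 / 2 + r) (by linarith [hrlt.2]) (by linarith) (by linarith [hrlt.2])
    (ENNReal.div_ne_zero.2 ⟨hc2, hKfin⟩)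
  have hψJ : MapsTo ψ J J := mapsTo_of_eqOn_compl ψ.injective hψid
  have hends : EqOn (extendReal (ψ.trans (S.map i))) (extendReal (S.map i)) (ends β) := by
    intro x hx
    have hx01 := ends_subset hβ' hx
    rw [extendReal_of_mem _ hx01, extendReal_of_mem _ hx01, Homeomorph.trans_apply, hψid]
    rintro ⟨h1, h2⟩
    rcases hx with hx | hx
    · linarith [hx.2, hrlt.2]
    · linarith [hx.1, hrlt.2]
  have hψS : IsCPlus β (ψ.trans (S.map i)) :=
    (S.isCPlus i).congr_of_eqOn_ends (ψ.trans (S.map i)).continuous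
      ((S.isCPlus i).monotone.comp hψ.monotone) hβ hends
  set T := S.precomp i ψ hψS with hT
  have hTi : T.map i = ψ.trans (S.map i) := Function.update_self _ _ _
  have hTj : ∀ l, l ≠ i → T.map l = S.map l := fun l hl => Function.update_of_ne hl _ _
  have hTJ : ∀ l, ∀ x ∉ J, T.map l x = S.map l x := by
    intro l x hx
    rcases eq_or_ne l i with rfl | hl
    · rw [hTi, Homeomorph.trans_apply, hψid x hx]
    · rw [hTj l hl]
  have hTS : dist T S < min ε ε' := by
    refine hdist T rfl (fun l x => ?_) fun l x hx => ?_
    · by_cases hx : x ∈ J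
      · rcases eq_or_ne l i with rfl | hl
        · have h1 := (hball (hJz x hx)).2.2.2.2
          have h2 := (hball (hJz _ (hψJ hx))).2.2.2.2
          rw [hTi, Homeomorph.trans_apply, ← Real.dist_eq, ← Subtype.dist_eq]
          linarith [dist_triangle_right (S.map l (ψ x)) (S.map l x) (S.map l z)]
        · rw [hTj l hl, sub_self, abs_zero]; exact he.le
      · rw [hTJ l x hx, sub_self, abs_zero]; exact he.le
    · rcases eq_or_ne l i with rfl | hl
      · rw [hTi, endDeriv, endDeriv, derivWithin_congr hends (hends hx), sub_self, abs_zero]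
        exact he.le
      · rw [hTj l hl, sub_self, abs_zero]; exact he.le
  have hmoves : ∀ x : unitInterval, 0 < x → x < 1 → ∃ i j, T.map i x < x ∧ x < T.map j x := by
    intro x hx0 hx1
    by_cases hx : x ∈ J
    · have h1 := hball (hJz x hx)
      have hji : j ≠ i := by rintro rfl; exact lt_asymm hi hj
      refine ⟨i, j, ?_, ?_⟩
      · rw [hTi]
        exact (hball (hJz _ (hψJ hx))).1.trans h1.2.1
      · rw [hTj j hji]
        exact h1.2.2.1.trans h1.2.2.2.1
    · obtain ⟨i', j', h⟩ := hS.1.moves x hx0 hx1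
      exact ⟨i', j', by rwa [hTJ i' x hx, hTJ j' x hx]⟩
  have hTac : ∀ l, AbsolutelyContinuousOnInterval (extendReal (T.map l)) 0 1 := by
    intro l
    rcases eq_or_ne l i with rfl | hl
    · rw [hTi, show ⇑(ψ.trans (S.map l)) = S.map l ∘ ψ from rfl, extendReal_comp]
      exact absolutelyContinuousOnInterval_comp (hS.2 l) hψac
        (monotone_extendReal hψ.monotone) fun x _ => by
          rw [uIcc_of_le zero_le_one]; exact (ψ _).2
    · rw [hTj l hl]; exact hS.2 l
  have hTmem : T ∈ admissibleAC k β :=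
    ⟨hadm T rfl (hTS.trans_le (min_le_right _ _)) hmoves, hTac⟩
  refine ⟨T, hTmem, hTS.trans_le (min_le_left _ _),
    hasConcentratedStationary_of_volume_lt hβ hTmem hc fun B hB hTB hnull => ?_⟩
  have hAB : volume (A ∩ B) = 0 := by
    refine hnull i A hA ?_
    rw [hTi, show ⇑(ψ.trans (S.map i)) = S.map i ∘ ψ from rfl, image_comp]
    exact volume_image_eq_zero (S.isCPlus i) (hS.2 i) hψA
  have hBJ : volume (B ∩ J) ≤ c / 2 / (1 + k * K) ^ n := by
    refine le_trans (measure_mono (t := A ∩ B ∪ J \ A) fun x hx => ?_)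
      ((measure_union_le _ _).trans (by rw [hAB, zero_add]; exact hJA))
    by_cases hxA : x ∈ A
    · exact Or.inl ⟨hxA, hx.1⟩
    · exact Or.inr ⟨hx.2, hxA⟩
  have hreach : volume (B ∩ reachSet S J n) ≤ c / 2 :=
    (volume_inter_reachSet_le (fun l => (hexp l).lipschitzWith_symm ht) hTJ hTB n).trans
      ((mul_le_mul_right hBJ _).trans ENNReal.mul_div_le)
  have hctop : volume (B ∩ reachSet S J n) ≠ ⊤ := measure_ne_top _ _
  calc volume B ≤ volume (B ∩ reachSet S J n) + volume (reachSet S J n)ᶜ := by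
        refine (measure_mono fun x hx => ?_).trans (measure_union_le _ _)
        by_cases hxr : x ∈ reachSet S J n
        · exact Or.inl ⟨hx, hxr⟩
        · exact Or.inr hxr
    _ < c / 2 + c / 2 := ENNReal.add_lt_add_of_le_of_lt hctop hreach hn
    _ = c := ENNReal.add_halves c

theorem exists_dist_lt_hasConcentratedStationary (hβ : 0 < β) (hβ' : β < 1 / 2) {S : IFS k β}
    (hS : S ∈ admissibleAC k β) {ε : ℝ} (hε : 0 < ε) {c : ENNReal} (hc : c ≠ 0) :
    ∃ T ∈ admissibleAC k β, dist T S < ε ∧ HasConcentratedStationary T c := by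
  have hε3 : 0 < ε / 3 := by positivity
  obtain ⟨S₁, hS₁, hd₁, t, ht, hexp₁⟩ := exists_expanding hβ hβ' hS hε3
  obtain ⟨S₂, hS₂, hd₂, hexp₂, hmin⟩ := exists_isMinimal hβ hβ' hS₁ ht hexp₁ hε3
  obtain ⟨T, hT, hd, hconc⟩ :=
    exists_hasConcentratedStationary hβ hβ' hS₂ (half_pos ht) hexp₂ hmin hε3 hc
  exact ⟨T, hT, by linarith [dist_triangle T S₂ S, dist_triangle S₂ S₁ S], hconc⟩

/-! ### Completeness -/

/-- On a convex set, a pointwise limit of functions whose derivatives converge uniformly is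
differentiable wherever the limit of the derivatives is continuous. -/
theorem hasDerivWithinAt_of_tendstoUniformlyOn {ι : Type*} {L : Filter ι} [L.NeBot] {s : Set ℝ}
    (hs : Convex ℝ s) {f f' : ι → ℝ → ℝ} {F D : ℝ → ℝ} {x : ℝ} (hx : x ∈ s)
    (hf : ∀ n, ∀ y ∈ s, HasDerivWithinAt (f n) (f' n y) s y) (hu : TendstoUniformlyOn f' D L s)
    (hD : ContinuousWithinAt D s x) (hF : ∀ y ∈ s, Tendsto (fun n => f n y) L (𝓝 (F y))) :
    HasDerivWithinAt F (D x) s x := by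
  rw [hasDerivWithinAt_iff_isLittleO, Asymptotics.isLittleO_iff]
  intro η hη
  obtain ⟨δ, hδ, hball⟩ := Metric.continuousWithinAt_iff.1 hD (η / 2) (half_pos hη)
  filter_upwards [self_mem_nhdsWithin, mem_nhdsWithin_of_mem_nhds (Metric.ball_mem_nhds x hδ)]
    with y hys hy
  have hlim : Tendsto (fun n => ‖f n y - f n x - (y - x) • D x‖) L
      (𝓝 ‖F y - F x - (y - x) • D x‖) := (((hF y hys).sub (hF x hx)).sub_const _).norm
  refine le_of_tendsto hlim ?_
  filter_upwards [Metric.tendstoUniformlyOn_iff.1 hu (η / 2) (half_pos hη)] with n hn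
  have h := (hs.inter (convex_ball x δ)).norm_image_sub_le_of_norm_hasDerivWithin_le
    (f := fun z => f n z - z * D x) (f' := fun z => f' n z - D x) (C := η) (x := x) (y := y)
    (fun z hz => (((hf n z hz.1).mono inter_subset_left).sub
      (((hasDerivAt_id z).mul_const (D x)).hasDerivWithinAt)).congr_deriv (by ring))
    (fun z hz => by
      have h1 := hn z hz.1
      have h2 := hball hz.1 hz.2
      rw [← dist_eq_norm]
      rw [dist_comm] at h1
      linarith [dist_triangle (f' n z) (D z) (D x)])
    ⟨hx, Metric.mem_ball_self hδ⟩ ⟨hys, hy⟩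
  rwa [show f n y - f n x - (y - x) • D x = f n y - y * D x - (f n x - x * D x) by
    rw [smul_eq_mul]; ring]

theorem supDist_le_of_forall {α : Type*} {u v : α → ℝ} {C : ℝ} (hC : 0 ≤ C)
    (h : ∀ a, |u a - v a| ≤ C) : supDist u v ≤ C :=
  Real.iSup_le h hC

theorem IFS.lipschitzWith_map (i : Fin k) :
    LipschitzWith 1 fun S : IFS k β => (S.map i : C(unitInterval, unitInterval)) :=
  LipschitzWith.mk_one fun S T => (ContinuousMap.dist_le dist_nonneg).2 fun x => by
    rw [Subtype.dist_eq, Real.dist_eq]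
    exact abs_map_sub_le S T i x

theorem IFS.lipschitzWith_symm (i : Fin k) :
    LipschitzWith 1 fun S : IFS k β => ((S.map i).symm : C(unitInterval, unitInterval)) :=
  LipschitzWith.mk_one fun S T => (ContinuousMap.dist_le dist_nonneg).2 fun x => by
    rw [Subtype.dist_eq, Real.dist_eq]
    exact abs_symm_sub_le S T i x

theorem IFS.lipschitzWith_prob (i : Fin k) : LipschitzWith 1 fun S : IFS k β => S.prob i :=
  LipschitzWith.mk_one fun S T => by
    rw [Real.dist_eq]
    exact abs_prob_sub_le S T i

instance : CompactSpace (ends β) := isCompact_iff_compactSpace.1 (isCompact_ends β)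

/-- The derivative near the endpoints as a continuous function. -/
def endDerivCM (hβ : 0 < β) (S : IFS k β) (i : Fin k) : C(ends β, ℝ) :=
  ⟨(ends β).domRestrict (endDeriv β (S.map i)),
    ((S.isCPlus i).continuousOn_endDeriv hβ).domRestrict⟩

theorem lipschitzWith_endDerivCM (hβ : 0 < β) (i : Fin k) :
    LipschitzWith 1 fun S : IFS k β => endDerivCM hβ S i :=
  LipschitzWith.mk_one fun S T => (ContinuousMap.dist_le dist_nonneg).2 fun x => by
    rw [Real.dist_eq]
    exact abs_endDeriv_sub_le S T i x.2

/-- A pointwise limit of maps in `C⁺_β` whose derivatives converge uniformly. -/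
theorem hasDerivWithinAt_extendReal_of_tendsto {g : ℕ → unitInterval → unitInterval}
    (hg : ∀ n, IsCPlus β (g n)) {f : unitInterval → unitInterval}
    (hf : ∀ x, Tendsto (fun n => g n x) atTop (𝓝 (f x))) {D : ℝ → ℝ}
    (hD : ContinuousOn D (ends β))
    (hu : TendstoUniformlyOn (fun n => endDeriv β (g n)) D atTop (ends β)) {x : ℝ}
    (hx : x ∈ ends β) : HasDerivWithinAt (extendReal f) (D x) (ends β) x := by
  have key : ∀ c d, Icc c d ⊆ ends β → HasDerivWithinAt (extendReal f) (D x) (Icc c d) x := by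
    intro c d hcd
    by_cases hxcd : x ∈ Icc c d
    · exact hasDerivWithinAt_of_tendstoUniformlyOn (convex_Icc c d) hxcd
        (fun n y hy => ((hg n).hasDerivWithinAt (hcd hy)).mono hcd) (hu.mono hcd)
        ((hD x hx).mono hcd) fun y _ => (continuous_subtype_val.tendsto _).comp (hf _)
    · exact HasFDerivWithinAt.of_notMem_closure (by rwa [isClosed_Icc.closure_eq])
  exact (key _ _ subset_union_left).union (key _ _ subset_union_right)

theorem completeSpace_IFS (hβ : 0 < β) : CompleteSpace (IFS k β) := by
  refine Metric.complete_of_cauchySeq_tendsto fun u hu => ?_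
  choose φ hφ using fun i => cauchySeq_tendsto_of_complete
    ((IFS.lipschitzWith_map (β := β) i).uniformContinuous.comp_cauchySeq hu)
  choose ψ hψ using fun i => cauchySeq_tendsto_of_complete
    ((IFS.lipschitzWith_symm (β := β) i).uniformContinuous.comp_cauchySeq hu)
  choose p hp using fun i => cauchySeq_tendsto_of_complete
    ((IFS.lipschitzWith_prob (β := β) i).uniformContinuous.comp_cauchySeq hu)
  choose D hD using fun i => cauchySeq_tendsto_of_complete
    ((lipschitzWith_endDerivCM hβ i).uniformContinuous.comp_cauchySeq hu)
  have hφx : ∀ i x, Tendsto (fun n => (u n).map i x) atTop (𝓝 (φ i x)) := fun i x =>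
    ((continuous_eval_const (F := C(unitInterval, unitInterval)) x).tendsto _).comp (hφ i)
  have hψφ : ∀ i x, ψ i (φ i x) = x := by
    intro i x
    have h := (hψ i).compCM (hφ i)
    refine tendsto_nhds_unique (((continuous_eval_const (F := C(unitInterval, unitInterval)) x).tendsto _).comp h) ?_
    refine tendsto_const_nhds.congr fun n => ?_
    exact (((u n).map i).symm_apply_apply x).symm
  have hφψ : ∀ i x, φ i (ψ i x) = x := by
    intro i x
    have h := (hφ i).compCM (hψ i)
    refine tendsto_nhds_unique (((continuous_eval_const (F := C(unitInterval, unitInterval)) x).tendsto _).comp h) ?_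
    refine tendsto_const_nhds.congr fun n => ?_
    exact (((u n).map i).apply_symm_apply x).symm
  set f : Fin k → (unitInterval ≃ₜ unitInterval) := fun i =>
    ⟨⟨φ i, ψ i, hψφ i, hφψ i⟩, (φ i).continuous, (ψ i).continuous⟩
  set D' : Fin k → ℝ → ℝ := fun i => Function.extend Subtype.val (D i) 0
  have hD'x : ∀ i (x : ends β), D' i x = D i x := fun i x =>
    Subtype.val_injective.extend_apply _ _ _
  have hD' : ∀ i, ContinuousOn (D' i) (ends β) := fun i => by
    rw [continuousOn_iff_continuous_domRestrict]
    exact (D i).continuous.congr fun x => (hD'x i x).symm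
  have hDu : ∀ i, TendstoUniformlyOn (fun n => endDeriv β ((u n).map i)) (D' i) atTop
      (ends β) := by
    intro i
    refine Metric.tendstoUniformlyOn_iff.2 fun η hη => ?_
    filter_upwards [Metric.tendsto_nhds.1 (hD i) η hη] with n hn x hx
    rw [hD'x i ⟨x, hx⟩, dist_comm]
    exact (ContinuousMap.dist_apply_le_dist (f := endDerivCM hβ (u n) i) ⟨x, hx⟩).trans_lt hn
  have hderiv : ∀ i, ∀ x ∈ ends β, HasDerivWithinAt (extendReal (f i)) (D' i x) (ends β) x :=
    fun i x hx => hasDerivWithinAt_extendReal_of_tendsto (fun n => (u n).isCPlus i) (hφx i)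
      (hD' i) (hDu i) hx
  have hdw : ∀ i, EqOn (endDeriv β (f i)) (D' i) (ends β) := fun i x hx =>
    (hderiv i x hx).derivWithin (uniqueDiffOn_ends hβ x hx)
  set T : IFS k β :=
    { map := f
      prob := p
      isCPlus := fun i => by
        refine ⟨(φ i).continuous, fun x y hxy => ?_, ?_, ?_, ?_⟩
        · exact le_of_tendsto_of_tendsto' (hφx i x) (hφx i y) fun n =>
            ((u n).isCPlus i).monotone hxy
        · exact tendsto_nhds_unique (hφx i 0)
            (tendsto_const_nhds.congr fun n => ((u n).isCPlus i).map_zero.symm)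
        · exact tendsto_nhds_unique (hφx i 1)
            (tendsto_const_nhds.congr fun n => ((u n).isCPlus i).map_one.symm)
        · exact (contDiffOn_one_iff_derivWithin (uniqueDiffOn_ends hβ)).2
            ⟨fun x hx => (hderiv i x hx).differentiableWithinAt, (hD' i).congr (hdw i)⟩
      prob_nonneg := fun i => ge_of_tendsto' (hp i) fun n => (u n).prob_nonneg i
      prob_sum := tendsto_nhds_unique (tendsto_finsetSum _ fun i _ => hp i)
        (tendsto_const_nhds.congr fun n => (u n).prob_sum.symm) }
  refine ⟨T, tendsto_iff_dist_tendsto_zero.2 ?_⟩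
  have hbound : ∀ n, dist (u n) T ≤ ∑ i, (dist ((u n).prob i) (p i) +
      dist ((u n).map i : C(unitInterval, unitInterval)) (φ i) +
      dist (((u n).map i).symm : C(unitInterval, unitInterval)) (ψ i) +
      dist (endDerivCM hβ (u n) i) (D i)) := by
    intro n
    refine Finset.sum_le_sum fun i _ => ?_
    refine add_le_add (add_le_add (add_le_add le_rfl ?_) ?_) ?_
    · exact supDist_le_of_forall dist_nonneg fun x =>
        ContinuousMap.dist_apply_le_dist (f := ((u n).map i : C(unitInterval, unitInterval)))
          (g := φ i) x
    · exact supDist_le_of_forall dist_nonneg fun x =>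
        ContinuousMap.dist_apply_le_dist
          (f := (((u n).map i).symm : C(unitInterval, unitInterval))) (g := ψ i) x
    · refine supDist_le_of_forall dist_nonneg fun x => ?_
      rw [hdw i x.2, hD'x]
      exact ContinuousMap.dist_apply_le_dist (f := endDerivCM hβ (u n) i) (g := D i) x
  refine squeeze_zero (fun _ => dist_nonneg) hbound ?_
  have hsum : (0 : ℝ) = ∑ _i : Fin k, 0 := Finset.sum_const_zero.symm
  refine Eq.mpr (congrArg (fun a : ℝ => Tendsto _ atTop (𝓝 a)) hsum) ?_
  refine tendsto_finsetSum _ fun i _ => ?_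
  simpa using (((tendsto_iff_dist_tendsto_zero.1 (hp i)).add
    (tendsto_iff_dist_tendsto_zero.1 (hφ i))).add
    (tendsto_iff_dist_tendsto_zero.1 (hψ i))).add (tendsto_iff_dist_tendsto_zero.1 (hD i))

end IntervalIFS

end

theorem mainTheorem1 (k : ℕ) (β : ℝ) (hβ : 0 < β) (hβ' : β < 1 / 2) :
    CompleteSpace (IntervalIFS.IFS k β) ∧
      {S : closure (IntervalIFS.admissibleAC k β) |
        IntervalIFS.HasUniqueSingularStationary (S : IntervalIFS.IFS k β)} ∈
        residual (closure (IntervalIFS.admissibleAC k β)) := by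
  exact ⟨IntervalIFS.completeSpace_IFS hβ,
    IntervalIFS.eventually_residual_hasUniqueSingularStationary hβ fun _ hS _ hε _ hc =>
      IntervalIFS.exists_dist_lt_hasConcentratedStationary hβ hβ' hS hε hc⟩
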